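/- For $r>0$ let $D_r=\{w\in\mathbb C:|w-1|<r\}$, and let $H^2(D_r)$ be the Hilbert space of holomorphic functions $f(w)=\sum_{k\ge0}c_k(w-1)^k$ on $D_r$ with $\|f\|_{H^2(D_r)}^2=\sum_{k\ge0}|c_k|^2r^{2k}<\infty$. The formula $$(\mathcal Lf)(w)=\sum_{n\ge1}\frac1{(w+n)^2}\,f\!\left(\frac1{w+n}\right),\qquad f\in H^2(D_1),\ w\in D_{3/2},$$ (the series converging absolutely) defines a bounded linear operator $\mathcal L:H^2(D_1)\to H^2(D_{3/2})$, the Gauss--Kuzmin--Wirsing operator. Put $C_2:=\|\mathcal L\|_{H^2(D_1)\to H^2(D_{3/2})}$, let $S:H^2(D_{3/2})\to H^2(D_1)$ be the restriction map $f\mapsto f|_{D_1}$, and set $$L_1:=S\mathcal L:H^2(D_1)\to H^2(D_1),\qquad L_{3/2}:=\mathcal LS:H^2(D_{3/2})\to H^2(D_{3/2}).$$ For a bounded operator $T$ on a Hilbert space and $m\ge1$ let $a_m(T)=\inf\{\|T-F\|:\operatorname{rank}F\le m-1\}$ be its $m$-th approximation number. For compact $T$ let $\lambda_1(T),\lambda_2(T),\dots$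 be its eigenvalues ordered by decreasing modulus, each nonzero one repeated according to its algebraic multiplicity (with zeros appended if there are only finitely many nonzero ones), and let $s_m(T)=\lambda_m(T^*T)^{1/2}$ be its singular values; $T$ is trace class if it is compact and $\|T\|_{S_1}:=\sum_{m\ge1}s_m(T)<\infty$. Then for $L=L_1$ and for $L=L_{3/2}$: 1. $a_m(L)\le C_2\left(\tfrac23\right)^{m-1}$ for every $m\ge1$; 2. $L$ is trace class, and $\|L\|_{S_1}\le 3C_2$; 3. $|\lambda_m(L)|\le C_2\left(\tfrac23\right)^{m-1}$ for every $m\ge1$, and $\sum_{m\ge1}|\lambda_m(L)|<\infty$. -/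

import Mathlib

open Metric

noncomputable section

/-- The open disc `D_r = {w : |w - 1| < r}` in the complex plane. -/
abbrev Disc (r : ℝ) : Set ℂ := ball (1 : ℂ) r

/-- `c` is a sequence of Taylor coefficients at `1` exhibiting `f` as an element of `H²(D_r)`:
`f(w) = ∑ c_k (w-1)^k` on `D_r` (so `f` is holomorphic there) and `∑ |c_k|² r^{2k} < ∞`. -/
def IsHardyCoeff (r : ℝ) (f : Disc r → ℂ) (c : ℕ → ℂ) : Prop :=
  Summable (fun k => ‖c k‖ ^ 2 * r ^ (2 * k)) ∧
    ∀ w : Disc r, HasSum (fun k => c k * ((w : ℂ) - 1) ^ k) (f w)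

theorem IsHardyCoeff.add {r : ℝ} {f g : Disc r → ℂ} {c d : ℕ → ℂ}
    (hf : IsHardyCoeff r f c) (hg : IsHardyCoeff r g d) :
    IsHardyCoeff r (f + g) (c + d) := by
  refine ⟨?_, fun w => ?_⟩
  · refine Summable.of_nonneg_of_le (fun k => ?_) (fun k => ?_)
      ((hf.1.mul_left 2).add (hg.1.mul_left 2))
    · rw [pow_mul]; positivity
    · have h1 : ‖c k + d k‖ ^ 2 ≤ 2 * ‖c k‖ ^ 2 + 2 * ‖d k‖ ^ 2 := by
        have := norm_add_le (c k) (d k)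
        nlinarith [norm_nonneg (c k + d k), sq_nonneg (‖c k‖ - ‖d k‖)]
      have h2 : 0 ≤ r ^ (2 * k) := by rw [pow_mul]; positivity
      have := mul_le_mul_of_nonneg_right h1 h2
      simp only [Pi.add_apply]
      linarith
  · simpa [add_mul] using (hf.2 w).add (hg.2 w)

theorem IsHardyCoeff.smul {r : ℝ} {f : Disc r → ℂ} {c : ℕ → ℂ} (a : ℂ)
    (hf : IsHardyCoeff r f c) : IsHardyCoeff r (a • f) (a • c) := by
  refine ⟨?_, fun w => ?_⟩
  · simpa [mul_pow, mul_assoc] using hf.1.mul_left (‖a‖ ^ 2)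
  · simpa [mul_assoc] using (hf.2 w).mul_left a

theorem IsHardyCoeff.unique {r : ℝ} (hr : 0 < r) {f : Disc r → ℂ} {c d : ℕ → ℂ}
    (hc : IsHardyCoeff r f c) (hd : IsHardyCoeff r f d) : c = d := by
  have key : HasFPowerSeriesAt (fun _ : ℂ => (0 : ℂ))
      (FormalMultilinearSeries.ofScalars ℂ (c - d)) (1 : ℂ) := by
    rw [hasFPowerSeriesAt_iff]
    filter_upwards [ball_mem_nhds (0 : ℂ) hr] with z hz
    have hw : (1 : ℂ) + z ∈ Disc r := by simpa using hz
    have h := (hc.2 ⟨1 + z, hw⟩).sub (hd.2 ⟨1 + z, hw⟩)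
    simpa [FormalMultilinearSeries.coeff_ofScalars, mul_comm, mul_sub] using h
  have h0 := key.eq_zero
  funext k
  have := congrArg (fun p => FormalMultilinearSeries.coeff p k) h0
  simp only [FormalMultilinearSeries.coeff_ofScalars] at this
  simpa [sub_eq_zero, FormalMultilinearSeries.coeff] using this

/-- The Hardy space `H²(D_r)`, as a space of functions on the disc `D_r`. -/
def HardySubmodule (r : ℝ) : Submodule ℂ (Disc r → ℂ) where
  carrier := {f | ∃ c, IsHardyCoeff r f c}
  add_mem' := by
    rintro f g ⟨c, hc⟩ ⟨d, hd⟩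
    exact ⟨c + d, hc.add hd⟩
  zero_mem' := ⟨0, by simp [IsHardyCoeff]⟩
  smul_mem' := by
    rintro a f ⟨c, hc⟩
    exact ⟨a • c, hc.smul a⟩

/-- The Hardy space `H²(D_r)` as a type; it carries the Hilbert space structure below. -/
def H2 (r : ℝ) : Type := HardySubmodule r

namespace H2

variable {r : ℝ}

instance : AddCommGroup (H2 r) := inferInstanceAs (AddCommGroup (HardySubmodule r))

instance : Module ℂ (H2 r) := inferInstanceAs (Module ℂ (HardySubmodule r))

instance : CoeFun (H2 r) (fun _ => Disc r → ℂ) := ⟨fun f => f.1⟩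

/-- The Taylor coefficients at `1` of `f ∈ H²(D_r)`. -/
def coeff (f : H2 r) : ℕ → ℂ := Classical.choose f.2

theorem isHardyCoeff (f : H2 r) : IsHardyCoeff r f f.coeff := Classical.choose_spec f.2

theorem memlp_coeff (f : H2 r) :
    Memℓp (E := fun _ : ℕ => ℂ) (fun k => f.coeff k * (r : ℂ) ^ k) 2 := by
  refine memℓp_gen ?_
  refine f.isHardyCoeff.1.congr (fun k => ?_)
  simp [mul_pow, ← pow_mul, mul_comm k 2]
  simp [pow_mul]

/-- `f ↦ (c_k r^k)_k`, a linear map into `ℓ²`. -/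
def toLp (r : ℝ) [hr : Fact (0 < r)] : H2 r →ₗ[ℂ] lp (fun _ : ℕ => ℂ) 2 where
  toFun f := ⟨fun k => f.coeff k * (r : ℂ) ^ k, f.memlp_coeff⟩
  map_add' f g := by
    have h : (f + g).coeff = f.coeff + g.coeff :=
      (f + g).isHardyCoeff.unique hr.out (f.isHardyCoeff.add g.isHardyCoeff)
    ext k
    simp only [h, Pi.add_apply, add_mul]
    rfl
  map_smul' a f := by
    have h : (a • f).coeff = a • f.coeff :=
      (a • f).isHardyCoeff.unique hr.out (f.isHardyCoeff.smul a)
    ext k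
    simp [h, mul_assoc]

theorem toLp_apply [Fact (0 < r)] (f : H2 r) (k : ℕ) :
    (toLp r f : ℕ → ℂ) k = f.coeff k * (r : ℂ) ^ k := rfl

theorem toLp_injective (r : ℝ) [hr : Fact (0 < r)] : Function.Injective (toLp r) := by
  intro f g h
  have hc : f.coeff = g.coeff := by
    funext k
    have hk := congrArg (fun x : lp (fun _ : ℕ => ℂ) 2 => (x : ℕ → ℂ) k) h
    simp only [toLp_apply] at hk
    exact mul_right_cancel₀ (pow_ne_zero k (by exact_mod_cast hr.out.ne')) hk
  apply Subtype.ext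
  funext w
  have h1 := f.isHardyCoeff.2 w
  rw [hc] at h1
  exact h1.unique (g.isHardyCoeff.2 w)

theorem toLp_surjective (r : ℝ) [hr : Fact (0 < r)] : Function.Surjective (toLp r) := by
  intro a
  have hr0 : (r : ℂ) ≠ 0 := by exact_mod_cast hr.out.ne'
  let c : ℕ → ℂ := fun k => a k / (r : ℂ) ^ k
  have hs : ∀ w : Disc r, Summable (fun k => c k * ((w : ℂ) - 1) ^ k) := by
    intro w
    have hw : ‖(w : ℂ) - 1‖ < r := by
      have := w.2
      rwa [mem_ball, dist_eq_norm] at this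
    have hq : ‖(w : ℂ) - 1‖ / r < 1 := (div_lt_one hr.out).2 hw
    refine Summable.of_norm_bounded
      ((summable_geometric_of_lt_one (div_nonneg (norm_nonneg _) hr.out.le) hq).mul_left ‖a‖) ?_
    intro k
    have h1 : ‖a k‖ ≤ ‖a‖ := lp.norm_apply_le_norm (by norm_num) a k
    have h2 : ‖c k * ((w : ℂ) - 1) ^ k‖ = ‖a k‖ * (‖(w : ℂ) - 1‖ / r) ^ k := by
      simp only [c, norm_mul, norm_div, norm_pow, Complex.norm_real, Real.norm_eq_abs,
        abs_of_pos hr.out, div_pow]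
      ring
    rw [h2]
    exact mul_le_mul_of_nonneg_right h1 (pow_nonneg (div_nonneg (norm_nonneg _) hr.out.le) k)
  have hc : IsHardyCoeff r (fun w => ∑' k, c k * ((w : ℂ) - 1) ^ k) c := by
    refine ⟨?_, fun w => (hs w).hasSum⟩
    have h := (lp.memℓp a).summable (by norm_num)
    refine h.congr (fun k => ?_)
    have hk : (r ^ k) ≠ 0 := pow_ne_zero k hr.out.ne'
    simp only [c, norm_div, norm_pow, Complex.norm_real, Real.norm_eq_abs, abs_of_pos hr.out,
      ENNReal.toReal_ofNat, Real.rpow_ofNat, div_pow]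
    rw [mul_comm 2 k, pow_mul]
    field_simp
  let f : H2 r := ⟨_, c, hc⟩
  refine ⟨f, ?_⟩
  have hfc : f.coeff = c := f.isHardyCoeff.unique hr.out hc
  ext k
  rw [toLp_apply, hfc]
  exact div_mul_cancel₀ _ (pow_ne_zero k hr0)

/-- The norm of `H²(D_r)`; see `H2.norm_sq_eq` for the formula. -/
instance [Fact (0 < r)] : NormedAddCommGroup (H2 r) :=
  NormedAddCommGroup.induced (H2 r) (lp (fun _ : ℕ => ℂ) 2) (toLp r) (toLp_injective r)

/-- The inner product of `H²(D_r)`; see `H2.inner_eq` for the formula. -/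
instance [Fact (0 < r)] : InnerProductSpace ℂ (H2 r) where
  norm_smul_le a f := by
    change ‖toLp r (a • f)‖ ≤ ‖a‖ * ‖toLp r f‖
    rw [map_smul, norm_smul]
  inner f g := inner ℂ (toLp r f) (toLp r g)
  norm_sq_eq_re_inner f := norm_sq_eq_re_inner (𝕜 := ℂ) (toLp r f)
  conj_inner_symm f g := inner_conj_symm (toLp r f) (toLp r g)
  add_left f g h := by
    rw [map_add]
    exact inner_add_left _ _ _
  smul_left f g a := by
    rw [map_smul]
    exact inner_smul_left _ _ _

/-- The isometric isomorphism of `H²(D_r)` with `ℓ²`. -/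
def equivLp (r : ℝ) [Fact (0 < r)] : H2 r ≃ₗᵢ[ℂ] lp (fun _ : ℕ => ℂ) 2 where
  toLinearEquiv := LinearEquiv.ofBijective (toLp r) ⟨toLp_injective r, toLp_surjective r⟩
  norm_map' _ := rfl

instance [Fact (0 < r)] : CompleteSpace (H2 r) :=
  (completeSpace_congr (e := (equivLp r).toLinearEquiv.toEquiv)
    (equivLp r).isometry.isUniformEmbedding).2 inferInstance

/-- `‖f‖² = ∑ |c_k|² r^{2k}`. -/
theorem norm_sq_eq [Fact (0 < r)] (f : H2 r) :
    ‖f‖ ^ 2 = ∑' k, ‖f.coeff k‖ ^ 2 * r ^ (2 * k) := by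
  have h := lp.norm_rpow_eq_tsum (p := 2) (by norm_num) (toLp r f)
  simp only [ENNReal.toReal_ofNat, Real.rpow_ofNat, toLp_apply] at h
  change ‖toLp r f‖ ^ 2 = _
  rw [h]
  refine tsum_congr (fun k => ?_)
  simp [mul_pow, ← pow_mul, mul_comm k 2]
  simp [pow_mul]

/-- `⟨g, f⟩ = ∑ c_k (conj d_k) r^{2k}`, with the conjugate in the slot where Mathlib has it. -/
theorem inner_eq [Fact (0 < r)] (f g : H2 r) :
    inner ℂ g f = ∑' k, f.coeff k * (starRingEnd ℂ) (g.coeff k) * (r : ℂ) ^ (2 * k) := by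
  change inner ℂ (toLp r g) (toLp r f) = _
  rw [lp.inner_eq_tsum]
  refine tsum_congr (fun k => ?_)
  simp only [toLp_apply, RCLike.inner_apply, map_mul, map_pow, Complex.conj_ofReal]
  ring

theorem isHardyCoeff_restrict {R : ℝ} (hr : 0 ≤ r) (h : r ≤ R) (f : H2 R) :
    IsHardyCoeff r (fun w => f ⟨w, ball_subset_ball h w.2⟩) f.coeff := by
  refine ⟨?_, fun w => f.isHardyCoeff.2 ⟨w, ball_subset_ball h w.2⟩⟩
  refine Summable.of_nonneg_of_le (fun k => by positivity) (fun k => ?_) f.isHardyCoeff.1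
  gcongr

/-- The restriction map `J_{R→r} : H²(D_R) → H²(D_r)`, `f ↦ f|_{D_r}`, for `0 < r ≤ R`. -/
def restrict {r R : ℝ} [hr : Fact (0 < r)] [Fact (0 < R)] (h : r ≤ R) : H2 R →L[ℂ] H2 r :=
  LinearMap.mkContinuous
    { toFun := fun f => ⟨fun w => f ⟨w, ball_subset_ball h w.2⟩, f.coeff,
        isHardyCoeff_restrict hr.out.le h f⟩
      map_add' := fun _ _ => rfl
      map_smul' := fun _ _ => rfl } 1 (by
    intro f
    rw [one_mul]
    refine le_of_sq_le_sq ?_ (norm_nonneg _)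
    rw [norm_sq_eq, norm_sq_eq]
    have hf := isHardyCoeff_restrict hr.out.le h f
    set g : H2 r := ⟨fun w => f ⟨w, ball_subset_ball h w.2⟩, f.coeff, hf⟩ with hg
    have hgc : g.coeff = f.coeff := g.isHardyCoeff.unique hr.out hf
    change ∑' k, ‖g.coeff k‖ ^ 2 * r ^ (2 * k) ≤ _
    rw [hgc]
    refine Summable.tsum_le_tsum (fun k => ?_) hf.1 f.isHardyCoeff.1
    have := hr.out.le
    gcongr)

theorem restrict_apply {r R : ℝ} [Fact (0 < r)] [Fact (0 < R)] (h : r ≤ R) (f : H2 R)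
    (w : Disc r) : restrict h f w = f ⟨w, ball_subset_ball h w.2⟩ := rfl

end H2

instance fact_pos_one : Fact ((0 : ℝ) < 1) := ⟨one_pos⟩

instance fact_pos_three_halves : Fact ((0 : ℝ) < 3 / 2) := ⟨by norm_num⟩

/-- The inverse branch `τ_{n+1}(w) = 1/(w + n + 1)` of the Gauss map maps `D_{3/2}` into `D_1`. -/
theorem gaussBranch_mem (n : ℕ) (w : Disc (3 / 2)) : 1 / ((w : ℂ) + (n + 1)) ∈ Disc 1 := by
  have hw : ‖(w : ℂ) - 1‖ < 3 / 2 := by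
      have := w.2
      rwa [mem_ball, dist_eq_norm] at this
  have hre : -(1 / 2) < (w : ℂ).re := by
    have h1 := (Complex.abs_re_le_norm ((w : ℂ) - 1)).trans_lt hw
    have h2 := (abs_lt.1 h1).1
    simp only [Complex.sub_re, Complex.one_re] at h2
    linarith
  have hn : (0 : ℝ) ≤ n := n.cast_nonneg
  have hne : (w : ℂ) + (n + 1) ≠ 0 := by
    intro h
    have := congrArg Complex.re h
    simp at this
    linarith
  rw [mem_ball, dist_eq_norm]
  have e : 1 / ((w : ℂ) + (n + 1)) - 1 = -((w : ℂ) + n) / ((w : ℂ) + (n + 1)) := by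
    field_simp
    ring
  rw [e, norm_div, norm_neg, div_lt_one (norm_pos_iff.2 hne)]
  refine lt_of_pow_lt_pow_left₀ 2 (norm_nonneg _) ?_
  rw [Complex.sq_norm, Complex.sq_norm, Complex.normSq_apply, Complex.normSq_apply]
  simp
  nlinarith

/-- The inverse branch `τ_{n+1} : D_{3/2} → D_1`, `w ↦ 1/(w + n + 1)` (branches indexed from 0). -/
def gaussBranch (n : ℕ) (w : Disc (3 / 2)) : Disc 1 :=
  ⟨1 / ((w : ℂ) + (n + 1)), gaussBranch_mem n w⟩

/-- `T` is the Gauss--Kuzmin--Wirsing operator from `H²(D_1)` to `H²(D_{3/2})`: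
`(T f)(w) = ∑_{n ≥ 1} (w+n)⁻² f(1/(w+n))` for all `f ∈ H²(D_1)` and `w ∈ D_{3/2}`. -/
def IsGKWOperator (T : H2 1 →L[ℂ] H2 (3 / 2)) : Prop :=
  ∀ (f : H2 1) (w : Disc (3 / 2)),
    HasSum (fun n : ℕ => 1 / ((w : ℂ) + (n + 1)) ^ 2 * f (gaussBranch n w)) (T f w)

/-- The restriction map `S : H²(D_{3/2}) → H²(D_1)`. -/
def restrictionS : H2 (3 / 2) →L[ℂ] H2 1 := H2.restrict (by norm_num)

section Operators

variable {H : Type*} [NormedAddCommGroup H] [InnerProductSpace ℂ H]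

/-- The `m`-th approximation number (`m ≥ 1`) of a bounded operator: the distance in operator
norm to the bounded operators of rank less than `m`. -/
def approxNumber (T : H →L[ℂ] H) (m : ℕ) : ℝ :=
  sInf {x : ℝ | ∃ F : H →L[ℂ] H, (F : H →ₗ[ℂ] H).rank < (m : Cardinal) ∧ x = ‖T - F‖}

/-- `ev` lists the eigenvalues of the compact operator `T` by decreasing modulus, every nonzero one
repeated according to its algebraic multiplicity (the dimension of its generalized eigenspace), and
with zeros appended if only finitely many are nonzero. Indices start at `0`, so `ev m` is the
eigenvalue number `m + 1`. -/
structure IsEigenvalueSequence (T : H →L[ℂ] H) (ev : ℕ → ℂ) : Prop where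
  antitone_norm : Antitone (fun m => ‖ev m‖)
  multiplicity : ∀ μ : ℂ, μ ≠ 0 → {m | ev m = μ}.encard =
    Cardinal.toENat (Module.rank ℂ (Module.End.maxGenEigenspace (T : H →ₗ[ℂ] H) μ))

variable [CompleteSpace H]

/-- `s` lists the singular values of the compact operator `T` in decreasing order with
multiplicity, indexed from `0`: the nonnegative square roots of the eigenvalues of `T* T`. -/
structure IsSingularValueSequence (T : H →L[ℂ] H) (s : ℕ → ℝ) : Prop where
  nonneg : ∀ m, 0 ≤ s m
  eigenvalues_sq : IsEigenvalueSequence (ContinuousLinearMap.adjoint T ∘L T)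
    (fun m => ((s m ^ 2 : ℝ) : ℂ))

/-- The trace norm `‖T‖_{S_1} = ∑ s_m` of `T` is (finite and) equal to `t`. -/
def HasTraceNorm (T : H →L[ℂ] H) (t : ℝ) : Prop :=
  ∃ s : ℕ → ℝ, IsSingularValueSequence T s ∧ HasSum s t

/-- `T` is trace class: it is compact and its singular values are summable. -/
def IsTraceClass (T : H →L[ℂ] H) : Prop :=
  IsCompactOperator T ∧ ∃ t, HasTraceNorm T t

end Operators

end

/-! The approximation and trace bounds come from the restriction `S`. Cutting the Taylor series at
`1` after `i` terms costs at most `(2/3) ^ i` in norm, so `L₁` and `L₃₂` lie within `‖𝓛‖ (2/3) ^ i`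
of operators of rank at most `i`. Singular values obey the same bounds by min-max, and the geometric
series gives the factor `3`.

The eigenvalue bound needs more. Weyl's inequality controls only the product of the first
eigenvalues by the product of these errors, and taking roots would halve the exponent. So a sharper
approximation of `L₁` is used (`IsGKWOperator.approxBy_golden`). The branch `τ(w) = 1/(w+1)` maps
the half-plane `Re w > -1/2` onto `D_1` and fixes `φ - 1` and `-φ`. In the Möbius coordinate sending
these points to `0` and `∞`, the half-plane becomes the unit disc and `τ` becomes multiplication by
`-φ⁻²`, so `D_1` becomes the disc of radius `φ⁻²`. Hence `L₁` factors through a restriction with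
errors `φ⁻²ⁱ`, up to the constant `2φ⁻¹`. The halved exponent now yields `2φ⁻¹ φ⁻ᵐ` for the
eigenvalue of index `m` counted from `0`. It remains to see `φ⁻¹ ≤ 2/3`, and `2φ⁻¹ ≤ ‖𝓛‖`, which
follows by testing `𝓛` on the invariant density. Since `AB` and `BA` have the same nonzero
eigenvalues, `L₃₂` inherits the bound.

The constant `2`, and the boundedness of `𝓛`, come from a Gram identity. Let `b_w` and `g_w` be
`branchVec` and `gkwVec`, so that `g_w` represents `f ↦ (𝓛f)(w)`. A telescoping double sum gives
`⟨g_w, g_z⟩ = ⟨g_w, b_z⟩ + ⟨b_w, g_z⟩`. Thus the `b_w - g_w` have the same Gram kernel as the `b_w`: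
the map `K : b_w ↦ g_w` makes `1 - K` isometric, and `‖K‖ ≤ 2`. -/

noncomputable section

/-! ### Triangular flags and algebraic multiplicity -/

section Flag

variable {K M : Type*} [Field K] [AddCommGroup M] [Module K M]

/-- `IsFlag T l V`: the subspace `V` is built from `0` by successively adjoining vectors `v`, not in
the subspace built so far, on which `T` acts modulo that subspace as the scalars listed in `l`. -/
inductive IsFlag (T : Module.End K M) : List K → Submodule K M → Prop
  | nil : IsFlag T [] ⊥
  | cons {l : List K} {V : Submodule K M} {μ : K} {v : M} : IsFlag T l V → v ∉ V →
      T v - μ • v ∈ V → IsFlag T (μ :: l) (V ⊔ K ∙ v)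

namespace IsFlag

variable {T : Module.End K M} {l : List K} {V : Submodule K M}

theorem le_comap (h : IsFlag T l V) : V ≤ V.comap T := by
  induction h with
  | nil => exact bot_le
  | @cons l V μ v _ _ hv ih =>
    refine sup_le (fun x hx => Submodule.mem_sup_left (ih hx)) ?_
    rw [Submodule.span_singleton_le_iff_mem, Submodule.mem_comap]
    have : T v = (T v - μ • v) + μ • v := by abel
    rw [this]
    exact add_mem (Submodule.mem_sup_left hv)
      (Submodule.mem_sup_right (Submodule.smul_mem _ _ (Submodule.mem_span_singleton_self v)))

theorem finiteDimensional (h : IsFlag T l V) : FiniteDimensional K V := by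
  induction h with
  | nil => infer_instance
  | cons _ _ _ ih => infer_instance

theorem finrank_eq (h : IsFlag T l V) : Module.finrank K V = l.length := by
  induction h with
  | nil => simp
  | @cons l V μ v hV hv _ ih =>
    have := hV.finiteDimensional
    have h0 : v ≠ 0 := fun h => hv (h ▸ V.zero_mem)
    have h1 := Submodule.finrank_sup_add_finrank_inf_eq V (K ∙ v)
    have h2 : V ⊓ K ∙ v = ⊥ := by
      rw [← disjoint_iff, Submodule.disjoint_span_singleton' h0] 
      exact hv
    rw [h2, finrank_bot, finrank_span_singleton h0, ih] at h1
    simpa using h1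

/-- Modulo the invariant subspace `V`, the operator `T - ν` multiplies `v` by `μ - ν`. -/
theorem pow_sub_apply_mem (hV : V ≤ V.comap T) {μ ν : K} {v : M} (hv : T v - μ • v ∈ V)
    (k : ℕ) {x : M} {c : K} (hx : x - c • v ∈ V) :
    ((T - algebraMap K (Module.End K M) ν) ^ k) x - (c * (μ - ν) ^ k) • v ∈ V := by
  induction k with
  | zero => simpa using hx
  | succ k ih =>
    set y := ((T - algebraMap K (Module.End K M) ν) ^ k) x
    set d := c * (μ - ν) ^ k
    rw [pow_succ', Module.End.mul_apply]
    have e : (T - algebraMap K (Module.End K M) ν) y - (c * (μ - ν) ^ (k + 1)) • v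
        = (T (y - d • v) - ν • (y - d • v)) + d • (T v - μ • v) := by
      simp only [LinearMap.sub_apply, Module.algebraMap_end_apply, map_sub, map_smul, pow_succ,
        d]
      module
    rw [e]
    exact add_mem (sub_mem (hV ih) (V.smul_mem _ ih)) (V.smul_mem _ hv)

/-- Adjoining `v` enlarges the intersection only if some generalized eigenvector has a nonzero
`v`-component. A power of `T - ν` kills it, which forces `μ = ν`; the gain is then at most one
dimension. -/
theorem finrank_inf_le [DecidableEq K] (h : IsFlag T l V) (ν : K) :
    Module.finrank K (V ⊓ T.maxGenEigenspace ν : Submodule K M) ≤ l.count ν := by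
  induction h with
  | nil => simp
  | @cons l V μ v hV hv hTv ih =>
    have := hV.finiteDimensional
    set E := T.maxGenEigenspace ν
    have dec : ∀ x ∈ V ⊔ K ∙ v, ∃ c : K, x - c • v ∈ V := by
      intro x hx
      obtain ⟨y, hy, z, hz, rfl⟩ := Submodule.mem_sup.1 hx
      obtain ⟨c, rfl⟩ := Submodule.mem_span_singleton.1 hz
      exact ⟨c, by simpa using hy⟩
    by_cases hle : (V ⊔ K ∙ v) ⊓ E ≤ V
    · have : (V ⊔ K ∙ v) ⊓ E = V ⊓ E :=
        le_antisymm (le_inf hle inf_le_right) (inf_le_inf_right _ le_sup_left)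
      rw [this]
      exact ih.trans (List.count_le_count_cons)
    · obtain ⟨x, ⟨hx1, hx2⟩, hxV⟩ := Set.not_subset.1 hle
      obtain ⟨c, hc⟩ := dec x hx1
      have hc0 : c ≠ 0 := by
        rintro rfl
        exact hxV (by simpa using hc)
      have hμν : μ = ν := by
        by_contra hne
        obtain ⟨k, hk⟩ := (Module.End.mem_maxGenEigenspace _ _ _).1 hx2
        have := pow_sub_apply_mem hV.le_comap (ν := ν) hTv k hc
        rw [Algebra.algebraMap_eq_smul_one, hk, zero_sub, neg_mem_iff] at this
        exact hv ((V.smul_mem_iff (mul_ne_zero hc0 (pow_ne_zero _ (sub_ne_zero.2 hne)))).1 this)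
      subst hμν
      rw [List.count_cons_self]
      have hsub : (V ⊔ K ∙ v) ⊓ E ≤ (V ⊓ E) ⊔ K ∙ x := by
        rintro y ⟨hy1, hy2⟩
        obtain ⟨d, hd⟩ := dec y hy1
        have e : y = (y - (d / c) • x) + (d / c) • x := by abel
        rw [e]
        refine add_mem (Submodule.mem_sup_left ⟨?_, sub_mem hy2 (E.smul_mem _ hx2)⟩)
          (Submodule.mem_sup_right (Submodule.smul_mem _ _ (Submodule.mem_span_singleton_self x)))
        have e2 : y - (d / c) • x = (y - d • v) - (d / c) • (x - c • v) := by
          rw [smul_sub, smul_smul, div_mul_cancel₀ _ hc0]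
          abel
        rw [e2]
        exact sub_mem hd (V.smul_mem _ hc)
      refine (Submodule.finrank_mono hsub).trans ((Submodule.finrank_add_le_finrank_add_finrank _ _).trans ?_)
      exact add_le_add ih (finrank_span_singleton (K := K) (v := x) (fun h => hxV (h ▸ V.zero_mem))).le

/-- By `finrank_inf_le` some generalized eigenvector lies outside `V`. Its last image under powers
of `T - μ` that is still outside `V` can be adjoined. -/
theorem exists_cons [DecidableEq K] (h : IsFlag T l V) {μ : K}
    (hμ : (l.count μ : ℕ∞) < Cardinal.toENat (Module.rank K (T.maxGenEigenspace μ))) :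
    ∃ W, IsFlag T (μ :: l) W := by
  have hfin := h.finiteDimensional
  have hle : ¬ T.maxGenEigenspace μ ≤ V := by
    intro hle
    have h1 := h.finrank_inf_le μ
    rw [inf_eq_right.2 hle] at h1
    have : FiniteDimensional K (T.maxGenEigenspace μ) := Submodule.finiteDimensional_of_le hle
    rw [← Module.finrank_eq_rank, Cardinal.toENat_nat, Nat.cast_lt] at hμ
    omega
  obtain ⟨x, hx, hxV⟩ := Set.not_subset.1 hle
  obtain ⟨k, hk⟩ := (Module.End.mem_maxGenEigenspace _ _ _).1 hx
  have hex : ∃ k, ((T - μ • (1 : Module.End K M)) ^ k) x ∈ V := ⟨k, by simp [hk]⟩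
  classical
  obtain ⟨j, hj⟩ : ∃ j, Nat.find hex = j + 1 := by
    refine Nat.exists_eq_succ_of_ne_zero fun h0 => hxV ?_
    have := Nat.find_spec hex
    rw [h0] at this
    simpa using this
  refine ⟨_, h.cons (v := ((T - μ • (1 : Module.End K M)) ^ j) x)
    (Nat.find_min hex (by omega)) ?_⟩
  have := Nat.find_spec hex
  rw [hj, pow_succ', Module.End.mul_apply] at this
  simpa using this

theorem exists_of_count_le [DecidableEq K] (l : List K)
    (hl : ∀ μ ∈ l, (l.count μ : ℕ∞) ≤ Cardinal.toENat (Module.rank K (T.maxGenEigenspace μ))) :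
    ∃ V, IsFlag T l V := by
  induction l with
  | nil => exact ⟨_, .nil⟩
  | cons μ l ih =>
    obtain ⟨V, hV⟩ := ih fun ν hν => le_trans (by exact_mod_cast List.count_le_count_cons)
      (hl ν (List.mem_cons_of_mem _ hν))
    refine hV.exists_cons (lt_of_lt_of_le ?_ (hl μ List.mem_cons_self))
    rw [List.count_cons_self]
    exact_mod_cast Nat.lt_succ_self _

theorem mem_of_apply_eq_smul (h : IsFlag T l V) {x : M} {μ : K} (hx : x ∈ V) (hx0 : x ≠ 0)
    (hTx : T x = μ • x) : μ ∈ l := by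
  classical
  have := h.finiteDimensional
  by_contra hμ
  have h1 := h.finrank_inf_le μ
  rw [List.count_eq_zero_of_not_mem hμ, Nat.le_zero, Submodule.finrank_eq_zero] at h1
  refine hx0 ((Submodule.mem_bot K).1 (h1 ▸ ⟨hx, ?_⟩))
  exact (Module.End.mem_maxGenEigenspace _ _ _).2 ⟨1, by simp [hTx]⟩

/-- Determinants multiply along an invariant subspace and its quotient; each step of the flag has a
one-dimensional quotient on which `T` is `μ`. -/
theorem det_restrict (h : IsFlag T l V) : (T.restrict h.le_comap).det = l.prod := by
  induction h with
  | nil => exact LinearMap.det_eq_one_of_subsingleton _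
  | @cons l V μ v hV hv hTv ih =>
    have hV' := hV.cons hv hTv
    have := hV.finiteDimensional
    have := hV'.finiteDimensional
    set V' : Submodule K M := V ⊔ K ∙ v with hVdef
    set A : Module.End K V' := T.restrict hV'.le_comap with hA
    set W : Submodule K V' := V.submoduleOf V' with hW
    have hWA : W ≤ W.comap A := fun x hx => hV.le_comap hx
    have hle : V ≤ V' := le_sup_left
    rw [LinearMap.det_eq_det_mul_det (W := W) A hWA, List.prod_cons, mul_comm]
    congr 1
    · have hq : W.mapQ W A hWA = μ • LinearMap.id := by
        ext ⟨x, hx⟩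
        simp only [LinearMap.comp_apply, Submodule.mkQ_apply, Submodule.mapQ_apply,
          LinearMap.smul_apply, LinearMap.id_apply, ← Submodule.Quotient.mk_smul]
        rw [Submodule.Quotient.eq]
        change T x - μ • x ∈ V
        obtain ⟨y, hy, z, hz, rfl⟩ := Submodule.mem_sup.1 hx
        obtain ⟨c, rfl⟩ := Submodule.mem_span_singleton.1 hz
        have e : T (y + c • v) - μ • (y + c • v) = (T y - μ • y) + c • (T v - μ • v) := by
          simp only [map_add, map_smul]
          module
        rw [e]
        exact add_mem (sub_mem (hV.le_comap hy) (V.smul_mem _ hy)) (V.smul_mem _ hTv)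
      have hd : Module.finrank K (V' ⧸ W) = 1 := by
        have h1 := Submodule.finrank_quotient_add_finrank W
        have h2 : Module.finrank K W = Module.finrank K V :=
          (Submodule.submoduleOfEquivOfLe hle).finrank_eq
        rw [h2, hV.finrank_eq, hV'.finrank_eq, List.length_cons] at h1
        omega
      rw [hq, LinearMap.det_smul, hd]
      simp
    · rw [← ih, ← LinearMap.det_conj _ (Submodule.submoduleOfEquivOfLe hle)]
      congr 1

end IsFlag

end Flag

/-! ### Finite-rank approximation and Weyl's inequality -/

section Approx

universe u

variable {E F G H : Type u} [NormedAddCommGroup E] [InnerProductSpace ℂ E]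
  [NormedAddCommGroup F] [InnerProductSpace ℂ F] [NormedAddCommGroup G] [InnerProductSpace ℂ G]
  [NormedAddCommGroup H] [InnerProductSpace ℂ H]

/-- For each `i`, the operator `T` is within `α i` of an operator of rank at most `i`. -/
def ApproxBy (T : E →L[ℂ] F) (α : ℕ → ℝ) : Prop :=
  ∀ i : ℕ, ∃ A : E →L[ℂ] F, (A : E →ₗ[ℂ] F).rank < ((i + 1 : ℕ) : Cardinal) ∧ ‖T - A‖ ≤ α i

namespace ApproxBy

theorem nonneg {T : E →L[ℂ] F} {α : ℕ → ℝ} (h : ApproxBy T α) (i : ℕ) : 0 ≤ α i := by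
  obtain ⟨A, -, hA⟩ := h i
  exact (norm_nonneg _).trans hA

theorem mono {T : E →L[ℂ] F} {α β : ℕ → ℝ} (h : ApproxBy T α) (hαβ : ∀ i, α i ≤ β i) :
    ApproxBy T β := fun i => by
  obtain ⟨A, h1, h2⟩ := h i
  exact ⟨A, h1, h2.trans (hαβ i)⟩

theorem clm_comp {T : E →L[ℂ] F} {α : ℕ → ℝ} (h : ApproxBy T α) (S : F →L[ℂ] G) :
    ApproxBy (S ∘L T) (fun i => ‖S‖ * α i) := fun i => by
  obtain ⟨A, h1, h2⟩ := h i
  refine ⟨S ∘L A, ?_, ?_⟩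
  · exact (LinearMap.rank_comp_le_right (A : E →ₗ[ℂ] F) (S : F →ₗ[ℂ] G)).trans_lt h1
  · rw [← ContinuousLinearMap.comp_sub]
    exact (ContinuousLinearMap.opNorm_comp_le _ _).trans
      (mul_le_mul_of_nonneg_left h2 (norm_nonneg _))

theorem comp_clm {T : F →L[ℂ] G} {α : ℕ → ℝ} (h : ApproxBy T α) (S : E →L[ℂ] F) :
    ApproxBy (T ∘L S) (fun i => α i * ‖S‖) := fun i => by
  obtain ⟨A, h1, h2⟩ := h i
  refine ⟨A ∘L S, ?_, ?_⟩
  · exact (LinearMap.rank_comp_le_left (S : E →ₗ[ℂ] F) (A : F →ₗ[ℂ] G)).trans_lt h1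
  · rw [← ContinuousLinearMap.sub_comp]
    exact (ContinuousLinearMap.opNorm_comp_le _ _).trans
      (mul_le_mul_of_nonneg_right h2 (norm_nonneg _))

theorem approxNumber_le {T : H →L[ℂ] H} {α : ℕ → ℝ} (h : ApproxBy T α) {m : ℕ} (hm : 1 ≤ m) :
    approxNumber T m ≤ α (m - 1) := by
  obtain ⟨A, h1, h2⟩ := h (m - 1)
  rw [Nat.sub_add_cancel hm] at h1
  refine le_trans (csInf_le ⟨0, ?_⟩ ⟨A, h1, rfl⟩) h2
  rintro _ ⟨_, _, rfl⟩
  exact norm_nonneg _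

theorem isCompactOperator [CompleteSpace F] {T : E →L[ℂ] F} {α : ℕ → ℝ} (h : ApproxBy T α)
    (hα : Filter.Tendsto α Filter.atTop (nhds 0)) : IsCompactOperator T := by
  choose A h1 h2 using h
  have hlim : Filter.Tendsto A Filter.atTop (nhds T) := by
    rw [tendsto_iff_norm_sub_tendsto_zero]
    refine squeeze_zero (fun _ => norm_nonneg _) (fun i => ?_) hα
    rw [norm_sub_rev]
    exact h2 i
  refine isCompactOperator_of_tendsto hlim (Filter.Eventually.of_forall fun i => ?_)
  have hfin : FiniteDimensional ℂ (A i : E →ₗ[ℂ] F).range :=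
    Module.rank_lt_aleph0_iff.1 ((h1 i).trans (Cardinal.natCast_lt_aleph0))
  have hA : A i = (A i : E →ₗ[ℂ] F).range.subtypeL ∘L
      (A i).codRestrict (A i : E →ₗ[ℂ] F).range (fun x => ⟨x, rfl⟩) := by
    ext x
    rfl
  have := FiniteDimensional.proper ℂ (A i : E →ₗ[ℂ] F).range
  rw [hA]
  exact IsCompactOperator.clm_comp (isCompactOperator_of_locallyCompactSpace_dom
    ((A i).codRestrict (A i : E →ₗ[ℂ] F).range (fun x => ⟨x, rfl⟩)))
    (A i : E →ₗ[ℂ] F).range.subtypeL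

end ApproxBy

/-- Among the first `i + 1` eigenvectors of a symmetric operator, some combination is killed by a
given map of rank at most `i`. -/
theorem LinearMap.IsSymmetric.exists_ker_quadratic [FiniteDimensional ℂ E] {A : E →ₗ[ℂ] E}
    (hA : A.IsSymmetric) {n : ℕ} (hn : Module.finrank ℂ E = n) (i : Fin n) (B : E →ₗ[ℂ] F)
    (hB : B.rank < ((i + 1 : ℕ) : Cardinal)) :
    ∃ x : E, x ≠ 0 ∧ B x = 0 ∧ hA.eigenvalues hn i * ‖x‖ ^ 2 ≤ (inner ℂ x (A x)).re := by
  set b := hA.eigenvectorBasis hn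
  let ι : Fin (i + 1) → Fin n := Fin.castLE i.2
  have hι : Function.Injective ι := Fin.castLE_injective _
  have hli : LinearIndependent ℂ (b ∘ ι) :=
    b.orthonormal.linearIndependent.comp ι hι
  let L : (Fin (i + 1) → ℂ) →ₗ[ℂ] E := Fintype.linearCombination ℂ (b ∘ ι)
  have hL : Function.Injective L := by
    exact linearIndependent_iff_injective_fintypeLinearCombination.1 hli
  -- The `i + 1` coordinates cannot inject into the range of `B ∘ₗ L`, whose rank is at most `i`.
  have hker : ¬ Function.Injective (B ∘ₗ L) := by
    intro hinj
    have h1 := LinearMap.lift_rank_le_of_injective (B ∘ₗ L).rangeRestrict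
      (fun x y h => hinj (congrArg Subtype.val h))
    have h2 : (B ∘ₗ L).rank < ((i + 1 : ℕ) : Cardinal) :=
      (LinearMap.rank_comp_le_left L B).trans_lt hB
    rw [rank_fin_fun] at h1
    have h3 := (h1.trans_lt (Cardinal.lift_lt.2 h2))
    simp at h3
  obtain ⟨c, hc, hc0⟩ : ∃ c, (B ∘ₗ L) c = 0 ∧ c ≠ 0 := by
    by_contra hcon
    push Not at hcon
    exact hker ((injective_iff_map_eq_zero _).2 hcon)
  have hLc : L c = ∑ j, c j • b (ι j) := Fintype.linearCombination_apply ..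
  have horth : Orthonormal ℂ (b ∘ ι) := b.orthonormal.comp ι hι
  have hALc : A (L c) = ∑ j, ((hA.eigenvalues hn (ι j) : ℂ) * c j) • b (ι j) := by
    rw [hLc, map_sum]
    refine Finset.sum_congr rfl fun j _ => ?_
    rw [map_smul, hA.apply_eigenvectorBasis hn, smul_smul, mul_comm]
    rfl
  refine ⟨L c, fun h => hc0 (hL (h.trans (map_zero L).symm)), hc, ?_⟩
  have h1 : inner ℂ (L c) (A (L c)) = ∑ j, ((hA.eigenvalues hn (ι j) * ‖c j‖ ^ 2 : ℝ) : ℂ) := by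
    rw [hALc, hLc]
    have := horth.inner_sum c (fun j => (hA.eigenvalues hn (ι j) : ℂ) * c j) Finset.univ
    simp only [Function.comp_apply] at this
    rw [this]
    refine Finset.sum_congr rfl fun j _ => ?_
    have := RCLike.conj_mul (c j)
    push_cast
    rw [mul_left_comm, this]
    rfl
  have h2 : ‖L c‖ ^ 2 = ∑ j, ‖c j‖ ^ 2 := by
    have := horth.inner_sum c c Finset.univ
    simp only [Function.comp_apply] at this
    rw [← hLc, inner_self_eq_norm_sq_to_K] at this
    have h3 : ((‖L c‖ ^ 2 : ℝ) : ℂ) = ((∑ j, ‖c j‖ ^ 2 : ℝ) : ℂ) := by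
      push_cast
      refine Eq.trans this (Finset.sum_congr rfl fun j _ => ?_)
      rw [RCLike.conj_mul]
      rfl
    exact_mod_cast h3
  rw [h1, h2, ← Complex.ofReal_sum, Complex.ofReal_re, Finset.mul_sum]
  refine Finset.sum_le_sum fun j _ => mul_le_mul_of_nonneg_right ?_ (by positivity)
  refine hA.eigenvalues_antitone hn ?_
  change (j : ℕ) ≤ i
  omega

/-- Weyl's inequality for the product of finitely many eigenvalues. -/
theorem IsFlag.norm_prod_le {T : H →L[ℂ] H} {α : ℕ → ℝ} (hT : ApproxBy T α) {l : List ℂ}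
    {V : Submodule ℂ H} (h : IsFlag (T : H →ₗ[ℂ] H) l V) :
    ‖l.prod‖ ≤ ∏ i ∈ Finset.range l.length, α i := by
  have := h.finiteDimensional
  set R : V →ₗ[ℂ] V := (T : H →ₗ[ℂ] H).restrict h.le_comap
  -- The modulus of the determinant is the product of the singular values of the restriction. Each
  -- is at most `α i`, by testing on a vector killed by the approximant `A`.
  rw [← h.det_restrict, ← LinearMap.normDet_eq_norm_det, LinearMap.normDet_eq_prod_singularValues,
    h.finrank_eq]
  refine Finset.prod_le_prod (fun i _ => R.singularValues_nonneg i) fun i hi => ?_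
  obtain ⟨A, hA1, hA2⟩ := hT i
  have hi' : i < l.length := Finset.mem_range.1 hi
  obtain ⟨x, hx0, hAx, hx⟩ := R.isSymmetric_adjoint_comp_self.exists_ker_quadratic
    h.finrank_eq ⟨i, hi'⟩ ((A : H →ₗ[ℂ] H) ∘ₗ V.subtype)
    ((LinearMap.rank_comp_le_left _ _).trans_lt hA1)
  rw [← R.sq_singularValues_fin] at hx
  have hxpos : 0 < ‖x‖ := norm_pos_iff.2 hx0
  have h1 : (inner ℂ x ((LinearMap.adjoint R ∘ₗ R) x)).re = ‖R x‖ ^ 2 := by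
    rw [LinearMap.comp_apply, LinearMap.adjoint_inner_right, inner_self_eq_norm_sq_to_K]
    norm_cast
  have h2 : ‖R x‖ ≤ α i * ‖x‖ := by
    have h3 : ‖R x‖ = ‖(T - A) (x : H)‖ := by
      have : A (x : H) = 0 := hAx
      rw [sub_apply, this, sub_zero]
      rfl
    rw [h3]
    exact ((T - A).le_opNorm _).trans (mul_le_mul_of_nonneg_right hA2 (norm_nonneg _))
  rw [h1, ← mul_pow] at hx
  have h4 := le_of_sq_le_sq hx (norm_nonneg _)
  exact le_of_mul_le_mul_right (h4.trans h2) hxpos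

end Approx

/-! ### Listing a weighted set in decreasing order -/

section Enumeration

/-- A weighted set with finite superlevel sets can be numbered by decreasing weight. -/
theorem exists_injective_antitone_weight {X : Type*} (w : X → ℝ)
    (hfin : ∀ x, {y | w x ≤ w y}.Finite) :
    ∃ r : X → ℕ, Function.Injective r ∧ (∀ x y, r x ≤ r y → w y ≤ w x) ∧
      ∀ x n, n ≤ r x → ∃ y, r y = n := by
  classical
  -- Ties in weight are broken by a well-ordering. An element's position is its number of
  -- predecessors, so the positions form an initial segment of `ℕ`.
  let lt : X → X → Prop := fun y x => w x < w y ∨ w x = w y ∧ WellOrderingRel y x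
  have lt_trans : ∀ {x y z}, lt x y → lt y z → lt x z := by
    rintro x y z (h1 | ⟨h1, h1'⟩) (h2 | ⟨h2, h2'⟩)
    · exact Or.inl (h2.trans h1)
    · exact Or.inl (h2 ▸ h1)
    · exact Or.inl (h1 ▸ h2)
    · exact Or.inr ⟨h2.trans h1, _root_.trans h1' h2'⟩
  have lt_irrefl : ∀ x, ¬ lt x x := by
    rintro x (h | ⟨-, h⟩)
    · exact h.false
    · exact irrefl (r := WellOrderingRel) x h
  have lt_tri : ∀ x y, lt x y ∨ x = y ∨ lt y x := by
    intro x y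
    rcases lt_trichotomy (w x) (w y) with h | h | h
    · exact Or.inr (Or.inr (Or.inl h))
    · rcases trichotomous_of WellOrderingRel x y with h' | h' | h'
      · exact Or.inl (Or.inr ⟨h.symm, h'⟩)
      · exact Or.inr (Or.inl h')
      · exact Or.inr (Or.inr (Or.inr ⟨h, h'⟩))
    · exact Or.inl (Or.inl h)
  have hpred : ∀ x, {y | lt y x}.Finite := fun x =>
    (hfin x).subset fun y hy => hy.elim le_of_lt fun h => h.1.le
  let r : X → ℕ := fun x => {y | lt y x}.ncard
  have hr : ∀ {x y}, lt x y → r x < r y := fun {x y} h =>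
    Set.ncard_lt_ncard ⟨fun z hz => lt_trans hz h, fun hs => lt_irrefl x (hs h)⟩ (hpred y)
  have hinj : Function.Injective r := by
    intro x y hxy
    rcases lt_tri x y with h | h | h
    · exact absurd hxy (hr h).ne
    · exact h
    · exact absurd hxy (hr h).ne'
  refine ⟨r, hinj, fun x y hxy => ?_, fun x n hn => ?_⟩
  · rcases lt_tri x y with h | rfl | h
    · exact h.elim le_of_lt fun h => h.1.le
    · exact le_rfl
    · exact absurd hxy (hr h).not_ge
  · rcases hn.eq_or_lt with rfl | hn
    · exact ⟨x, rfl⟩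
    have himg : (r '' {y | lt y x}) = Set.Iio (r x) := by
      refine Set.eq_of_subset_of_ncard_le ?_ ?_ (Set.finite_Iio _)
      · rintro _ ⟨y, hy, rfl⟩
        exact hr hy
      · rw [Set.ncard_image_of_injective _ hinj, Set.ncard_eq_toFinset_card']
        simp [r]
    obtain ⟨y, -, hy⟩ := himg.symm ▸ (show n ∈ Set.Iio (r x) from hn)
    exact ⟨y, hy⟩

/-- A multiplicity function with finite superlevel sets is realized by a sequence of decreasing
modulus, with zeros appended if necessary. -/
theorem exists_antitone_norm_encard_eq (d : ℂ → ℕ)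
    (hfin : ∀ ε : ℝ, 0 < ε → {μ : ℂ | ε ≤ ‖μ‖ ∧ d μ ≠ 0}.Finite) :
    ∃ ev : ℕ → ℂ, Antitone (fun m => ‖ev m‖) ∧
      ∀ μ : ℂ, μ ≠ 0 → {m | ev m = μ}.encard = d μ := by
  classical
  -- One element for each copy of a nonzero eigenvalue, counted with multiplicity.
  let X := Σ μ : {μ : ℂ // μ ≠ 0}, Fin (d μ)
  have hX : ∀ x : X, {y : X | ‖(x.1 : ℂ)‖ ≤ ‖(y.1 : ℂ)‖}.Finite := by
    intro x
    have h1 := hfin ‖(x.1 : ℂ)‖ (norm_pos_iff.2 x.1.2)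
    have h2 : {μ : {μ : ℂ // μ ≠ 0} | ‖(x.1 : ℂ)‖ ≤ ‖(μ : ℂ)‖ ∧ d μ ≠ 0}.Finite :=
      h1.preimage Subtype.val_injective.injOn
    refine (h2.biUnion (t := fun μ => Set.range fun j : Fin (d μ) => (⟨μ, j⟩ : X))
      fun μ _ => Set.finite_range _).subset ?_
    rintro ⟨μ, j⟩ h
    exact Set.mem_biUnion (show _ ∧ _ from ⟨h, fun h0 => (Fin.cast h0 j).elim0⟩) ⟨j, rfl⟩
  obtain ⟨r, hinj, hanti, hinit⟩ := exists_injective_antitone_weight (fun x : X => ‖(x.1 : ℂ)‖) hX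
  let ev : ℕ → ℂ := fun n => if h : ∃ x, r x = n then (h.choose.1 : ℂ) else 0
  have hev : ∀ x, ev (r x) = x.1 := by
    intro x
    have h : ∃ y, r y = r x := ⟨x, rfl⟩
    simp only [ev, dif_pos h]
    rw [hinj h.choose_spec]
  have hev0 : ∀ n, ev n ≠ 0 → ∃ x, r x = n := by
    intro n hn
    by_contra h
    exact hn (dif_neg h)
  refine ⟨ev, fun m n hmn => ?_, fun μ hμ => ?_⟩
  · by_cases hn : ev n = 0
    · simp [hn]
    obtain ⟨y, rfl⟩ := hev0 n hn
    obtain ⟨x, rfl⟩ := hinit y m hmn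
    simp only [hev]
    exact hanti x y hmn
  · have : {m | ev m = μ} = Set.range fun j : Fin (d μ) => r ⟨⟨μ, hμ⟩, j⟩ := by
      ext m
      constructor
      · rintro rfl
        obtain ⟨⟨ν, j⟩, rfl⟩ := hev0 m hμ
        have h := hev ⟨ν, j⟩
        have hν : ν = ⟨ev (r ⟨ν, j⟩), hμ⟩ := Subtype.ext h.symm
        generalize ev (r ⟨ν, j⟩) = z at *
        subst hν
        exact ⟨j, rfl⟩
      · rintro ⟨j, rfl⟩
        exact hev _
    rw [this, ← Set.image_univ, Function.Injective.encard_image, Set.encard_univ]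
    · simp
    · intro i j hij
      exact eq_of_heq (Sigma.mk.inj (hinj hij)).2

end Enumeration

/-! ### Eigenvalue sequences: bounds and existence -/

section Eigenvalues

universe u

variable {H : Type u} [NormedAddCommGroup H] [InnerProductSpace ℂ H]

theorem pow_length_le_norm_prod {ε : ℝ} (hε : 0 ≤ ε) (l : List ℂ) (hl : ∀ μ ∈ l, ε ≤ ‖μ‖) :
    ε ^ l.length ≤ ‖l.prod‖ := by
  induction l with
  | nil => simp
  | cons μ l ih =>
    rw [List.prod_cons, norm_mul, List.length_cons, pow_succ']
    exact mul_le_mul (hl μ List.mem_cons_self)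
      (ih fun ν hν => hl ν (List.mem_cons_of_mem _ hν)) (by positivity) (norm_nonneg _)

theorem IsEigenvalueSequence.exists_isFlag {T : H →L[ℂ] H} {ev : ℕ → ℂ}
    (h : IsEigenvalueSequence T ev) {n : ℕ} (hn : ∀ i < n, ev i ≠ 0) :
    ∃ V, IsFlag (T : H →ₗ[ℂ] H) ((List.range n).map ev) V := by
  classical
  refine IsFlag.exists_of_count_le _ fun μ hμ => ?_
  obtain ⟨i, hi, rfl⟩ := List.mem_map.1 hμ
  rw [← h.multiplicity _ (hn i (List.mem_range.1 hi))]
  rw [List.count_eq_countP, List.countP_map, List.countP_eq_length_filter]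
  have hnd : ((List.range n).filter ((fun x => x == ev i) ∘ ev)).Nodup :=
    List.nodup_range.filter _
  rw [← List.toFinset_card_of_nodup hnd, ← Set.encard_coe_eq_coe_finsetCard]
  refine Set.encard_le_encard fun j hj => ?_
  simpa using (List.mem_filter.1 (List.mem_toFinset.1 hj)).2

/-- By monotonicity `‖ev m‖ ^ (m + 1)` is at most the product of the first `m + 1` moduli, which
Weyl's inequality bounds by the product of the `α i`. -/
theorem IsEigenvalueSequence.norm_le {T : H →L[ℂ] H} {ev : ℕ → ℂ}
    (h : IsEigenvalueSequence T ev) {α : ℕ → ℝ} (hT : ApproxBy T α) (m : ℕ) {b : ℝ} (hb : 0 ≤ b)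
    (hαb : ∏ i ∈ Finset.range (m + 1), α i ≤ b ^ (m + 1)) : ‖ev m‖ ≤ b := by
  by_cases h0 : ev m = 0
  · simpa [h0]
  obtain ⟨V, hV⟩ := h.exists_isFlag (n := m + 1) fun i hi => by
    have := h.antitone_norm (Nat.lt_succ_iff.1 hi)
    exact norm_pos_iff.1 ((norm_pos_iff.2 h0).trans_le this)
  have h1 := hV.norm_prod_le hT
  have h2 := pow_length_le_norm_prod (norm_nonneg (ev m)) ((List.range (m + 1)).map ev) fun μ hμ => by
    obtain ⟨i, hi, rfl⟩ := List.mem_map.1 hμ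
    exact h.antitone_norm (Nat.lt_succ_iff.1 (List.mem_range.1 hi))
  rw [List.length_map, List.length_range] at h1 h2
  exact le_of_pow_le_pow_left₀ m.succ_ne_zero hb (h2.trans (h1.trans hαb))

/-- Weyl's inequality replaces Riesz theory: a flag of length `N` with all scalars of modulus at
least `ε` requires `ε ^ N ≤ ∏ α i`, which fails for some `N` because `α → 0`. This excludes both an
infinite multiplicity and infinitely many eigenvalues of modulus at least `ε`. -/
theorem exists_isEigenvalueSequence {T : H →L[ℂ] H} {α : ℕ → ℝ} (hT : ApproxBy T α)
    (hα : Filter.Tendsto α Filter.atTop (nhds 0)) : ∃ ev, IsEigenvalueSequence T ev := by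
  classical
  let e : ℂ → ℕ∞ := fun μ =>
    Cardinal.toENat (Module.rank ℂ (Module.End.maxGenEigenspace (T : H →ₗ[ℂ] H) μ))
  have key : ∀ ε : ℝ, 0 < ε → ∃ N : ℕ, ∀ l : List ℂ, l.length = N → (∀ μ ∈ l, ε ≤ ‖μ‖) →
      ¬ ∀ μ ∈ l, (l.count μ : ℕ∞) ≤ e μ := by
    intro ε hε
    obtain ⟨N, hN⟩ : ∃ N, ∏ i ∈ Finset.range N, α i < ε ^ N := by
      obtain ⟨N₀, hN₀⟩ := Filter.eventually_atTop.1 (hα.eventually (gt_mem_nhds (half_pos hε)))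
      set P := ∏ i ∈ Finset.range N₀, α i
      have hP : ∀ k, ∏ i ∈ Finset.range (N₀ + k), α i ≤ P * (ε / 2) ^ k := by
        intro k
        rw [Finset.prod_range_add]
        refine mul_le_mul_of_nonneg_left ?_ (Finset.prod_nonneg fun i _ => hT.nonneg i)
        refine (Finset.prod_le_prod (fun i _ => hT.nonneg _)
          fun i _ => (hN₀ (N₀ + i) (by omega)).le).trans_eq ?_
        simp [div_pow]
      have hlim : Filter.Tendsto (fun k : ℕ => P * (1 / 2 : ℝ) ^ k) Filter.atTop (nhds (P * 0)) :=
        (tendsto_pow_atTop_nhds_zero_of_lt_one (by norm_num) (by norm_num)).const_mul P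
      rw [mul_zero] at hlim
      obtain ⟨k, hk⟩ := (hlim.eventually (gt_mem_nhds (pow_pos hε N₀))).exists
      refine ⟨N₀ + k, (hP k).trans_lt ?_⟩
      have : P * (ε / 2) ^ k = (P * (1 / 2) ^ k) * ε ^ k := by
        rw [div_pow, div_pow]
        ring
      rw [this, pow_add]
      exact mul_lt_mul_of_pos_right hk (pow_pos hε k)
    refine ⟨N, fun l hl hle hcount => ?_⟩
    obtain ⟨V, hV⟩ := IsFlag.exists_of_count_le l hcount
    have h1 := hV.norm_prod_le hT
    rw [hl] at h1
    have h2 := pow_length_le_norm_prod hε.le l hle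
    rw [hl] at h2
    exact (h2.trans h1).not_gt hN
  have htop : ∀ μ, μ ≠ 0 → e μ ≠ ⊤ := by
    intro μ hμ htop
    obtain ⟨N, hN⟩ := key ‖μ‖ (norm_pos_iff.2 hμ)
    -- With infinite multiplicity, the list repeating `μ` would be admissible at every length.
    refine hN (List.replicate N μ) (by simp) (fun ν hν => ?_) fun ν hν => ?_
    · rw [List.eq_of_mem_replicate hν]
    · rw [List.eq_of_mem_replicate hν, htop]
      exact le_top
  obtain ⟨ev, h1, h2⟩ := exists_antitone_norm_encard_eq (fun μ => (e μ).toNat) fun ε hε => by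
    by_contra hinf
    obtain ⟨N, hN⟩ := key ε hε
    obtain ⟨s, hs, hsN⟩ := Set.Infinite.exists_subset_card_eq hinf N
    refine hN s.toList (by simpa) (fun μ hμ => (hs (Finset.mem_toList.1 hμ)).1) fun μ hμ => ?_
    rw [List.count_eq_one_of_mem s.nodup_toList hμ, Nat.cast_one, Order.one_le_iff_ne_zero]
    intro h0
    exact (hs (Finset.mem_toList.1 hμ)).2 (by simp [h0])
  exact ⟨ev, h1, fun μ hμ => (h2 μ hμ).trans (ENat.natCast_toNat (htop μ hμ))⟩

end Eigenvalues

/-! ### Singular values and the trace norm -/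

section SingularValues

universe u

variable {H : Type u} [NormedAddCommGroup H] [InnerProductSpace ℂ H] [CompleteSpace H]

theorem exists_isSingularValueSequence {T : H →L[ℂ] H} {α : ℕ → ℝ} (hT : ApproxBy T α)
    (hα : Filter.Tendsto α Filter.atTop (nhds 0)) : ∃ s, IsSingularValueSequence T s := by
  set A : H →L[ℂ] H := ContinuousLinearMap.adjoint T ∘L T with hA
  obtain ⟨ev, hev⟩ := exists_isEigenvalueSequence
    (hT.clm_comp (ContinuousLinearMap.adjoint T)) (by simpa using hα.const_mul _)
  -- A nonzero entry has a genuine eigenvector `x`, and its value is the Rayleigh quotient `‖T x‖² /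
  -- ‖x‖²`.
  have hpos : ∀ m, ∃ c : ℝ, 0 ≤ c ∧ ev m = c := by
    intro m
    by_cases h0 : ev m = 0
    · exact ⟨0, le_rfl, by simp [h0]⟩
    have h1 := hev.multiplicity (ev m) h0
    have hne : Module.End.maxGenEigenspace (A : H →ₗ[ℂ] H) (ev m) ≠ ⊥ := by
      intro hbot
      rw [hbot, rank_bot, map_zero, Set.encard_eq_zero] at h1
      exact (Set.eq_empty_iff_forall_notMem.1 h1 m) rfl
    have heig : Module.End.HasEigenvalue (A : H →ₗ[ℂ] H) (ev m) :=
      Module.End.HasUnifEigenvalue.lt (k := ⊤) (by simp) hne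
    obtain ⟨x, hx⟩ := heig.exists_hasEigenvector
    have hx1 : A x = ev m • x := hx.apply_eq_smul
    have h2 : inner ℂ x (A x) = ((‖T x‖ ^ 2 : ℝ) : ℂ) := by
      rw [hA, ContinuousLinearMap.comp_apply, ContinuousLinearMap.adjoint_inner_right,
        inner_self_eq_norm_sq_to_K]
      norm_cast
    have hx0 : ‖x‖ ^ 2 ≠ 0 := by
      have := norm_ne_zero_iff.2 hx.2
      positivity
    refine ⟨‖T x‖ ^ 2 / ‖x‖ ^ 2, by positivity, ?_⟩
    rw [hx1, inner_smul_right, inner_self_eq_norm_sq_to_K] at h2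
    have hx0' : ((‖x‖ : ℂ)) ^ 2 ≠ 0 := by exact_mod_cast hx0
    push_cast
    rw [eq_div_iff hx0']
    simpa using h2
  choose c hc0 hc using hpos
  refine ⟨fun m => Real.sqrt (c m), fun m => Real.sqrt_nonneg _, ?_⟩
  have : (fun m => ((Real.sqrt (c m) ^ 2 : ℝ) : ℂ)) = ev := by
    funext m
    rw [Real.sq_sqrt (hc0 m), hc]
  rw [this]
  exact hev

/-- On a flag for the first `n + 1` eigenvalues of `T* T`, that operator is symmetric with spectrum
at least `s n ^ 2`. A vector there killed by an approximant `F` of rank at most `n` satisfies `s n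
‖x‖ ≤ ‖T x‖ = ‖(T - F) x‖`. -/
theorem IsSingularValueSequence.le {T : H →L[ℂ] H} {s : ℕ → ℝ} (hs : IsSingularValueSequence T s)
    {α : ℕ → ℝ} (hT : ApproxBy T α) (n : ℕ) : s n ≤ α n := by
  set A : H →L[ℂ] H := ContinuousLinearMap.adjoint T ∘L T with hA
  rcases (hs.nonneg n).eq_or_lt with h0 | hpos
  · rw [← h0]
    exact hT.nonneg n
  have hanti : ∀ i ≤ n, s n ^ 2 ≤ s i ^ 2 := by
    intro i hi
    have := hs.eigenvalues_sq.antitone_norm hi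
    simpa [abs_of_nonneg, hs.nonneg] using this
  obtain ⟨V, hV⟩ := hs.eigenvalues_sq.exists_isFlag (n := n + 1) fun i hi => by
    have := (pow_pos hpos 2).trans_le (hanti i (by omega))
    exact_mod_cast this.ne'
  have := hV.finiteDimensional
  set R : V →ₗ[ℂ] V := (A : H →ₗ[ℂ] H).restrict hV.le_comap
  have hinner : ∀ x y : V, inner ℂ x (R y) = inner ℂ (T x) (T (y : H)) := by
    intro x y
    change inner ℂ (x : H) (A (y : H)) = _
    rw [hA, ContinuousLinearMap.comp_apply, ContinuousLinearMap.adjoint_inner_right]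
  have hsymm : R.IsSymmetric := by
    intro x y
    rw [← inner_conj_symm, hinner, hinner, inner_conj_symm]
  have hrank : Module.finrank ℂ V = n + 1 := by simpa using hV.finrank_eq
  obtain ⟨F, hF1, hF2⟩ := hT n
  obtain ⟨x, hx0, hFx, hx⟩ := hsymm.exists_ker_quadratic hrank (Fin.last n)
    ((F : H →ₗ[ℂ] H) ∘ₗ V.subtype) ((LinearMap.rank_comp_le_left _ _).trans_lt (by simpa using hF1))
  have heig : s n ^ 2 ≤ hsymm.eigenvalues hrank (Fin.last n) := by
    set lam := hsymm.eigenvalues hrank (Fin.last n) with hlam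
    obtain ⟨v, hv⟩ := (hsymm.hasEigenvalue_eigenvalues hrank (Fin.last n)).exists_hasEigenvector
    have hv1 : A (v : H) = (lam : ℂ) • (v : H) := congrArg Subtype.val hv.apply_eq_smul
    have := hV.mem_of_apply_eq_smul v.2 (fun h => hv.2 (Subtype.ext h)) hv1
    obtain ⟨i, hi, hi2⟩ := List.mem_map.1 this
    have : s i ^ 2 = lam := by exact_mod_cast hi2
    rw [← this]
    exact hanti i (by have := List.mem_range.1 hi; omega)
  have hxpos : 0 < ‖x‖ := norm_pos_iff.2 hx0
  rw [hinner, inner_self_eq_norm_sq_to_K] at hx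
  have h1 : s n ^ 2 * ‖x‖ ^ 2 ≤ ‖T x‖ ^ 2 := by
    refine (mul_le_mul_of_nonneg_right heig (by positivity)).trans (hx.trans_eq ?_)
    norm_cast
  have h2 : ‖T x‖ ≤ α n * ‖x‖ := by
    have h3 : T (x : H) = (T - F) (x : H) := by
      have : F (x : H) = 0 := hFx
      rw [sub_apply, this, sub_zero]
    rw [h3]
    exact ((T - F).le_opNorm _).trans (mul_le_mul_of_nonneg_right hF2 (norm_nonneg _))
  rw [← mul_pow] at h1
  exact le_of_mul_le_mul_right ((le_of_sq_le_sq h1 (norm_nonneg _)).trans h2) hxpos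

theorem ApproxBy.isTraceClass {T : H →L[ℂ] H} {C q : ℝ} (hq0 : 0 ≤ q) (hq1 : q < 1)
    (hT : ApproxBy T fun i => C * q ^ i) : IsTraceClass T := by
  have hα : Filter.Tendsto (fun i : ℕ => C * q ^ i) Filter.atTop (nhds 0) := by
    simpa using (tendsto_pow_atTop_nhds_zero_of_lt_one hq0 hq1).const_mul C
  obtain ⟨s, hs⟩ := exists_isSingularValueSequence hT hα
  exact ⟨hT.isCompactOperator hα, _, s, hs, (Summable.of_nonneg_of_le hs.nonneg (hs.le hT)
    ((summable_geometric_of_lt_one hq0 hq1).mul_left C)).hasSum⟩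

theorem ApproxBy.traceNorm_le {T : H →L[ℂ] H} {C q : ℝ} (hq0 : 0 ≤ q) (hq1 : q < 1)
    (hT : ApproxBy T fun i => C * q ^ i) {t : ℝ} (ht : HasTraceNorm T t) : t ≤ C * (1 - q)⁻¹ := by
  obtain ⟨s, hs, hst⟩ := ht
  exact hasSum_le (hs.le hT) hst ((hasSum_geometric_of_lt_one hq0 hq1).mul_left C)

end SingularValues

/-! ### Operators defined on total families through Gram kernels -/

section Families

variable {ι E F : Type*} [NormedAddCommGroup E] [InnerProductSpace ℂ E]
  [NormedAddCommGroup F] [InnerProductSpace ℂ F]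

theorem denseRange_linearCombination [CompleteSpace E] {x : ι → E}
    (hx : ∀ f : E, (∀ i, inner ℂ (x i) f = 0) → f = 0) :
    DenseRange (Finsupp.linearCombination ℂ x) := by
  have h : (Submodule.span ℂ (Set.range x))ᗮ = ⊥ := by
    refine (Submodule.eq_bot_iff _).2 fun f hf => hx f fun i => ?_
    exact (Submodule.mem_orthogonal _ _).1 hf _ (Submodule.subset_span ⟨i, rfl⟩)
  rw [← Submodule.topologicalClosure_eq_top_iff] at h
  have h2 : Dense ((Submodule.span ℂ (Set.range x) : Submodule ℂ E) : Set E) :=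
    (Submodule.dense_iff_topologicalClosure_eq_top).2 h
  rw [← Finsupp.range_linearCombination] at h2
  exact h2

/-- A bounded operator is determined by its values on a total family. -/
theorem exists_clm_of_norm_linearCombination_le [CompleteSpace E] [CompleteSpace F] {x : ι → E}
    {y : ι → F} (hx : ∀ f : E, (∀ i, inner ℂ (x i) f = 0) → f = 0) {C : ℝ} (hC : 0 ≤ C)
    (h : ∀ c : ι →₀ ℂ,
      ‖Finsupp.linearCombination ℂ y c‖ ≤ C * ‖Finsupp.linearCombination ℂ x c‖) :
    ∃ T : E →L[ℂ] F, ‖T‖ ≤ C ∧ ∀ i, T (x i) = y i := by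
  have hd := denseRange_linearCombination hx
  refine ⟨(Finsupp.linearCombination ℂ y).extendOfNorm (Finsupp.linearCombination ℂ x),
    ContinuousLinearMap.opNorm_le_bound _ hC (LinearMap.norm_extendOfNorm_apply_le hd C h),
    fun i => ?_⟩
  have := LinearMap.extendOfNorm_eq hd ⟨C, h⟩ (Finsupp.single i 1)
  simpa using this

theorem norm_linearCombination_sq (x : ι → E) (c : ι →₀ ℂ) :
    ((‖Finsupp.linearCombination ℂ x c‖ ^ 2 : ℝ) : ℂ) =
      ∑ i ∈ c.support, ∑ j ∈ c.support, (starRingEnd ℂ) (c i) * c j * inner ℂ (x i) (x j) := by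
  have h := inner_self_eq_norm_sq_to_K (𝕜 := ℂ) (Finsupp.linearCombination ℂ x c)
  rw [Complex.ofReal_pow]
  refine h.symm.trans ?_
  rw [Finsupp.linearCombination_apply, Finsupp.sum, sum_inner]
  refine Finset.sum_congr rfl fun i _ => ?_
  rw [inner_sum]
  refine Finset.sum_congr rfl fun j _ => ?_
  rw [inner_smul_left, inner_smul_right, mul_assoc]

theorem norm_linearCombination_eq_of_gram_eq {x : ι → E} {y : ι → F}
    (h : ∀ i j, inner ℂ (x i) (x j) = inner ℂ (y i) (y j)) (c : ι →₀ ℂ) :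
    ‖Finsupp.linearCombination ℂ x c‖ = ‖Finsupp.linearCombination ℂ y c‖ := by
  have : ‖Finsupp.linearCombination ℂ x c‖ ^ 2 = ‖Finsupp.linearCombination ℂ y c‖ ^ 2 := by
    have := norm_linearCombination_sq x c
    simp only [h] at this
    rw [← norm_linearCombination_sq y c] at this
    exact_mod_cast this
  exact (sq_eq_sq₀ (norm_nonneg _) (norm_nonneg _)).1 this

open scoped ComplexOrder in
/-- If the Gram kernel of `x` exceeds that of `y` by a product of two Gram kernels, then `x`
dominates `y`. -/
theorem norm_linearCombination_le_of_gram_sub_eq_mul {G G' : Type*} [NormedAddCommGroup G]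
    [InnerProductSpace ℂ G] [NormedAddCommGroup G'] [InnerProductSpace ℂ G'] {x : ι → E} {y : ι → F}
    {u : ι → G} {v : ι → G'} (h : ∀ i j, inner ℂ (x i) (x j) - inner ℂ (y i) (y j) =
      inner ℂ (u i) (u j) * inner ℂ (v i) (v j)) (c : ι →₀ ℂ) :
    ‖Finsupp.linearCombination ℂ y c‖ ≤ ‖Finsupp.linearCombination ℂ x c‖ := by
  classical
  -- Schur product theorem: the entrywise product of two Gram matrices is positive semidefinite.
  have hpsd := (Matrix.posSemidef_gram ℂ fun i : c.support => u i).hadamard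
    (Matrix.posSemidef_gram ℂ fun i : c.support => v i)
  have h1 := hpsd.dotProduct_mulVec_nonneg (fun i : c.support => c i)
  have h2 : (star (fun i : c.support => c i)) ⬝ᵥ
      ((Matrix.gram ℂ (fun i : c.support => u i)).hadamard
        (Matrix.gram ℂ fun i : c.support => v i)).mulVec (fun i : c.support => c i) =
      ((‖Finsupp.linearCombination ℂ x c‖ ^ 2 - ‖Finsupp.linearCombination ℂ y c‖ ^ 2 : ℝ) : ℂ) := by
    rw [Complex.ofReal_sub, norm_linearCombination_sq, norm_linearCombination_sq,
      ← Finset.sum_sub_distrib, ← Finset.sum_coe_sort c.support]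
    refine Finset.sum_congr rfl fun i _ => ?_
    rw [← Finset.sum_sub_distrib, Matrix.mulVec, dotProduct, Finset.mul_sum,
      ← Finset.sum_coe_sort c.support]
    refine Finset.sum_congr rfl fun j _ => ?_
    rw [← mul_sub, h]
    simp only [Pi.star_apply, RCLike.star_def, Matrix.hadamard_apply, Matrix.gram_apply]
    ring
  rw [h2] at h1
  have h3 : 0 ≤ ‖Finsupp.linearCombination ℂ x c‖ ^ 2 - ‖Finsupp.linearCombination ℂ y c‖ ^ 2 := by
    exact_mod_cast h1
  exact le_of_sq_le_sq (by linarith) (norm_nonneg _)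

end Families

/-! ### Nonzero spectrum of `AB` and `BA` -/

section Commute

variable {M N : Type*} [AddCommGroup M] [Module ℂ M] [AddCommGroup N] [Module ℂ N]

theorem LinearMap.apply_pow_comp_sub (A : N →ₗ[ℂ] M) (B : M →ₗ[ℂ] N) (μ : ℂ) (k : ℕ) (x : M) :
    B (((A ∘ₗ B - μ • (1 : Module.End ℂ M)) ^ k) x) =
      ((B ∘ₗ A - μ • (1 : Module.End ℂ N)) ^ k) (B x) := by
  induction k with
  | zero => simp
  | succ k ih =>
    rw [pow_succ', pow_succ', Module.End.mul_apply, Module.End.mul_apply, ← ih]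
    simp

end Commute

section CommuteRank

universe u

variable {M N : Type u} [AddCommGroup M] [Module ℂ M] [AddCommGroup N] [Module ℂ N]

/-- `B` intertwines `AB` with `BA`. It is injective on the generalized eigenspace: if `B x = 0`,
then `AB - μ` acts on `x` as `-μ ≠ 0` and no power of it kills `x` unless `x = 0`. -/
theorem LinearMap.rank_maxGenEigenspace_comp_le (A : N →ₗ[ℂ] M) (B : M →ₗ[ℂ] N) {μ : ℂ}
    (hμ : μ ≠ 0) : Module.rank ℂ (Module.End.maxGenEigenspace (A ∘ₗ B) μ) ≤
      Module.rank ℂ (Module.End.maxGenEigenspace (B ∘ₗ A) μ) := by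
  have hmaps : ∀ x ∈ Module.End.maxGenEigenspace (A ∘ₗ B) μ,
      B x ∈ Module.End.maxGenEigenspace (B ∘ₗ A) μ := by
    intro x hx
    obtain ⟨k, hk⟩ := (Module.End.mem_maxGenEigenspace _ _ _).1 hx
    refine (Module.End.mem_maxGenEigenspace _ _ _).2 ⟨k, ?_⟩
    rw [← apply_pow_comp_sub, hk, map_zero]
  refine LinearMap.rank_le_of_injective (B.restrict hmaps) ?_
  refine (injective_iff_map_eq_zero _).2 fun x hx => ?_
  have hBx : B (x : M) = 0 := congrArg Subtype.val hx
  obtain ⟨k, hk⟩ := (Module.End.mem_maxGenEigenspace _ _ _).1 x.2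
  have h1 : ∀ k : ℕ, ((A ∘ₗ B - μ • (1 : Module.End ℂ M)) ^ k) (x : M) = (-μ) ^ k • (x : M) := by
    intro k
    induction k with
    | zero => simp
    | succ k ih =>
      rw [pow_succ', Module.End.mul_apply, ih, pow_succ']
      simp [hBx, mul_smul, smul_comm μ]
  rw [h1] at hk
  exact Subtype.ext ((smul_eq_zero.1 hk).resolve_left (pow_ne_zero _ (neg_ne_zero.2 hμ)))

end CommuteRank

section CommuteSequence

universe u

variable {G H : Type u} [NormedAddCommGroup G] [InnerProductSpace ℂ G]
  [NormedAddCommGroup H] [InnerProductSpace ℂ H]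

/-- `A B` and `B A` have the same nonzero eigenvalues. -/
theorem IsEigenvalueSequence.comp_comm {A : G →L[ℂ] H} {B : H →L[ℂ] G} {ev : ℕ → ℂ}
    (h : IsEigenvalueSequence (A ∘L B) ev) : IsEigenvalueSequence (B ∘L A) ev := by
  refine ⟨h.antitone_norm, fun μ hμ => (h.multiplicity μ hμ).trans (congrArg _ ?_)⟩
  exact le_antisymm
    (LinearMap.rank_maxGenEigenspace_comp_le (A : G →ₗ[ℂ] H) (B : H →ₗ[ℂ] G) hμ)
    (LinearMap.rank_maxGenEigenspace_comp_le (B : H →ₗ[ℂ] G) (A : G →ₗ[ℂ] H) hμ)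

end CommuteSequence

/-! ### Reproducing kernels and Taylor truncation in `H²(D_r)` -/

namespace H2

variable {r R : ℝ}

theorem ext_apply {f g : H2 r} (h : ∀ w, f w = g w) : f = g := Subtype.ext (funext h)

theorem coeff_eq [hr : Fact (0 < r)] {f : H2 r} {c : ℕ → ℂ} (h : IsHardyCoeff r f.1 c) :
    f.coeff = c := f.isHardyCoeff.unique hr.out h

theorem coeff_add [hr : Fact (0 < r)] (f g : H2 r) : (f + g).coeff = f.coeff + g.coeff :=
  coeff_eq (f.isHardyCoeff.add g.isHardyCoeff)

theorem coeff_smul [hr : Fact (0 < r)] (a : ℂ) (f : H2 r) : (a • f).coeff = a • f.coeff :=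
  coeff_eq (f.isHardyCoeff.smul a)

/-- The Taylor coefficient of order `k` as a linear functional. -/
def coeffₗ (r : ℝ) [Fact (0 < r)] (k : ℕ) : H2 r →ₗ[ℂ] ℂ where
  toFun f := f.coeff k
  map_add' f g := by simp [coeff_add]
  map_smul' a f := by simp [coeff_smul]

theorem norm_sub_one_lt (w : Disc r) : ‖(w : ℂ) - 1‖ < r :=
  mem_ball_iff_norm.1 w.2

theorem kernCoeff (hr : 0 < r) (w : Disc r) :
    IsHardyCoeff r (fun z => (1 - ((z : ℂ) - 1) * (starRingEnd ℂ) ((w : ℂ) - 1) / (r : ℂ) ^ 2)⁻¹)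
      (fun k => ((starRingEnd ℂ) ((w : ℂ) - 1) / (r : ℂ) ^ 2) ^ k) := by
  have hw := norm_sub_one_lt w
  have hb : ‖(starRingEnd ℂ) ((w : ℂ) - 1) / (r : ℂ) ^ 2‖ = ‖(w : ℂ) - 1‖ / r ^ 2 := by
    rw [norm_div, norm_pow, RCLike.norm_conj, Complex.norm_real, Real.norm_of_nonneg hr.le]
  refine ⟨?_, fun z => ?_⟩
  · have h1 : ∀ k : ℕ, ‖((starRingEnd ℂ) ((w : ℂ) - 1) / (r : ℂ) ^ 2) ^ k‖ ^ 2 * r ^ (2 * k) =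
        ((‖(w : ℂ) - 1‖ / r) ^ 2) ^ k := by
      intro k
      rw [norm_pow, hb, pow_right_comm, pow_mul, ← mul_pow]
      congr 1
      field_simp
    simp only [h1]
    refine summable_geometric_of_lt_one (by positivity) ?_
    exact pow_lt_one₀ (by positivity) ((div_lt_one hr).2 hw) two_ne_zero
  · have hz := norm_sub_one_lt z
    have h1 : ‖((z : ℂ) - 1) * (starRingEnd ℂ) ((w : ℂ) - 1) / (r : ℂ) ^ 2‖ < 1 := by
      rw [mul_div_assoc, norm_mul, hb, ← mul_div_assoc, div_lt_one (by positivity), sq]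
      exact mul_lt_mul'' hz hw (norm_nonneg _) (norm_nonneg _)
    have h2 := hasSum_geometric_of_norm_lt_one h1
    refine h2.congr_fun fun k => ?_
    rw [← mul_pow]
    ring

/-- The reproducing kernel of `H²(D_r)` at `w`. -/
def kern (r : ℝ) [hr : Fact (0 < r)] (w : Disc r) : H2 r := ⟨_, _, kernCoeff hr.out w⟩

theorem kern_apply [Fact (0 < r)] (w z : Disc r) :
    kern r w z = (1 - ((z : ℂ) - 1) * (starRingEnd ℂ) ((w : ℂ) - 1) / (r : ℂ) ^ 2)⁻¹ := rfl

theorem inner_kern [hr : Fact (0 < r)] (w : Disc r) (f : H2 r) : inner ℂ (kern r w) f = f w := by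
  have hc : (kern r w).coeff = _ := coeff_eq (kernCoeff hr.out w)
  rw [inner_eq, hc]
  refine HasSum.tsum_eq ?_
  convert f.isHardyCoeff.2 w using 2 with k
  have hr0 : (r : ℂ) ≠ 0 := by exact_mod_cast hr.out.ne'
  simp only [map_pow, map_div₀, Complex.conj_conj, Complex.conj_ofReal]
  rw [mul_assoc, pow_mul, ← mul_pow, div_mul_cancel₀ _ (pow_ne_zero 2 hr0)]

theorem kern_total [Fact (0 < r)] (f : H2 r) (h : ∀ w, inner ℂ (kern r w) f = 0) : f = 0 :=
  ext_apply fun w => (inner_kern w f).symm.trans (h w)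

theorem inner_kern_kern [Fact (0 < r)] (w z : Disc r) : inner ℂ (kern r w) (kern r z) =
    (1 - ((w : ℂ) - 1) * (starRingEnd ℂ) ((z : ℂ) - 1) / (r : ℂ) ^ 2)⁻¹ := by
  rw [inner_kern, kern_apply]

theorem monomialCoeff (r : ℝ) (k : ℕ) :
    IsHardyCoeff r (fun z => ((z : ℂ) - 1) ^ k) (Pi.single k 1) := by
  refine ⟨summable_of_ne_finset_zero (s := {k}) fun j hj => ?_, fun w => ?_⟩
  · simp [Pi.single_eq_of_ne (Finset.notMem_singleton.1 hj)]
  · convert hasSum_single k fun j hj => ?_ using 1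
    · simp
    · simp [Pi.single_eq_of_ne hj]

/-- The monomial `(w - 1) ^ k` in `H²(D_r)`. -/
def monomial (r : ℝ) (k : ℕ) : H2 r := ⟨_, _, monomialCoeff r k⟩

theorem coeff_monomial [Fact (0 < r)] (k : ℕ) : (monomial r k).coeff = Pi.single k 1 :=
  coeff_eq (monomialCoeff r k)

theorem inner_monomial [Fact (0 < r)] (k : ℕ) (f : H2 r) :
    inner ℂ (monomial r k) f = f.coeff k * (r : ℂ) ^ (2 * k) := by
  rw [inner_eq, coeff_monomial, tsum_eq_single k fun j hj => ?_]
  · simp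
  · simp [Pi.single_eq_of_ne hj]

theorem coeff_restrict [hr : Fact (0 < r)] [Fact (0 < R)] (h : r ≤ R) (f : H2 R) :
    (restrict h f).coeff = f.coeff :=
  coeff_eq (isHardyCoeff_restrict hr.out.le h f)

/-- Taylor truncation approximates the restriction map `H²(D_R) → H²(D_r)`. -/
theorem approxBy_restrict [hr : Fact (0 < r)] [hR : Fact (0 < R)] (h : r ≤ R) :
    ApproxBy (restrict h) fun i => (r / R) ^ i := by
  classical
  intro i
  have hr0 := hr.out
  have hR0 := hR.out
  -- The Taylor polynomial of degree below `i`, its coefficients read off by inner products with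
  -- monomials so that continuity is automatic.
  let A : H2 R →L[ℂ] H2 r := ∑ k ∈ Finset.range i,
    (innerSL ℂ (((R : ℂ) ^ (2 * k))⁻¹ • monomial R k)).smulRight (monomial r k)
  have hA : ∀ f, A f = ∑ k ∈ Finset.range i, f.coeff k • monomial r k := by
    intro f
    simp only [A, sum_apply, ContinuousLinearMap.smulRight_apply,
      innerSL_apply_apply]
    refine Finset.sum_congr rfl fun k _ => ?_
    congr 1
    have hRk : (R : ℂ) ^ (2 * k) ≠ 0 := pow_ne_zero _ (by exact_mod_cast hR0.ne')
    rw [inner_smul_left, inner_monomial, map_inv₀, map_pow, Complex.conj_ofReal]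
    field_simp
  refine ⟨A, ?_, ContinuousLinearMap.opNorm_le_bound _ (by positivity) fun f => ?_⟩
  · have hle : LinearMap.range (A : H2 R →ₗ[ℂ] H2 r) ≤
        Submodule.span ℂ (((Finset.range i).image (monomial r) : Finset (H2 r)) : Set (H2 r)) := by
      rintro _ ⟨f, rfl⟩
      change A f ∈ _
      rw [hA]
      refine Submodule.sum_mem _ fun k hk => Submodule.smul_mem _ _ (Submodule.subset_span ?_)
      exact Finset.mem_coe.2 (Finset.mem_image_of_mem _ hk)
    refine ((Submodule.rank_mono hle).trans (rank_span_finset_le _)).trans_lt ?_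
    have := (Finset.card_image_le (s := Finset.range i) (f := monomial r)).trans_eq
      (Finset.card_range i)
    exact_mod_cast Nat.lt_succ_of_le this
  · have hc : ∀ k, ((restrict h - A) f).coeff k = if k < i then 0 else f.coeff k := by
      intro k
      have h1 : ((restrict h - A) f).coeff k = coeffₗ r k (restrict h f) - coeffₗ r k (A f) := by
        rw [← map_sub]
        rfl
      have h2 : coeffₗ r k (restrict h f) = f.coeff k := congrFun (coeff_restrict h f) k
      have h3 : ∀ j, coeffₗ r k (monomial r j) = (Pi.single j 1 : ℕ → ℂ) k :=
        fun j => congrFun (coeff_monomial j) k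
      rw [h1, h2, hA, map_sum]
      simp only [map_smul, h3, smul_eq_mul, Pi.single_apply, mul_ite, mul_one, mul_zero,
        Finset.sum_ite_eq, Finset.mem_range]
      split_ifs <;> simp
    refine le_of_sq_le_sq ?_ (by positivity)
    rw [mul_pow, norm_sq_eq, norm_sq_eq, ← tsum_mul_left]
    refine Summable.tsum_le_tsum (fun k => ?_) ((restrict h - A) f).isHardyCoeff.1
      (f.isHardyCoeff.1.mul_left _)
    rw [hc]
    split_ifs with hk
    · rw [norm_zero, zero_pow two_ne_zero, zero_mul]
      positivity
    · have h1 : r ^ (2 * k) = (r / R) ^ (2 * k) * R ^ (2 * k) := by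
        rw [← mul_pow, div_mul_cancel₀ _ hR0.ne']
      have h2 : (r / R) ^ (2 * k) ≤ ((r / R) ^ i) ^ 2 := by
        rw [← pow_mul]
        exact pow_le_pow_of_le_one (by positivity) ((div_le_one hR0).2 h) (by omega)
      rw [h1]
      calc ‖f.coeff k‖ ^ 2 * ((r / R) ^ (2 * k) * R ^ (2 * k))
          = (r / R) ^ (2 * k) * (‖f.coeff k‖ ^ 2 * R ^ (2 * k)) := by ring
        _ ≤ _ := mul_le_mul_of_nonneg_right h2 (by positivity)

end H2

/-! ### The telescoping double sum -/

section Telescoping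

theorem summable_nat_succ_rpow_neg_three_halves :
    Summable fun n : ℕ => ((n : ℝ) + 1) ^ (-(3 / 2) : ℝ) := by
  have h := (summable_nat_add_iff 1).2 (Real.summable_nat_rpow.2 (show (-(3 / 2) : ℝ) < -1 by norm_num))
  simpa using h

theorem re_add_natCast_le_norm (s : ℂ) (j : ℕ) : s.re + j ≤ ‖s + j‖ := by
  simpa using Complex.re_le_norm (s + j)

theorem add_natCast_ne_zero {s : ℂ} (hs : 0 < s.re) (j : ℕ) : s + j ≠ 0 := by
  have := re_add_natCast_le_norm s j
  have hj : (0 : ℝ) ≤ j := j.cast_nonneg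
  exact norm_pos_iff.1 (by linarith)

theorem min_mul_le_norm_add_natCast (s : ℂ) (j : ℕ) :
    min s.re 1 * ((j : ℝ) + 1) ≤ ‖s + j‖ := by
  refine le_trans ?_ (re_add_natCast_le_norm s j)
  have hj : (0 : ℝ) ≤ j := j.cast_nonneg
  have h1 := min_le_left s.re 1
  have h2 := min_le_right s.re 1
  nlinarith

theorem tendsto_inv_add_natCast (s : ℂ) :
    Filter.Tendsto (fun n : ℕ => (s + n)⁻¹) Filter.atTop (nhds 0) := by
  rw [tendsto_zero_iff_norm_tendsto_zero]
  simp only [norm_inv]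
  refine Filter.Tendsto.inv_tendsto_atTop ?_
  exact Filter.tendsto_atTop_mono (re_add_natCast_le_norm s)
    (Filter.tendsto_atTop_add_const_left _ _ tendsto_natCast_atTop_atTop)

theorem hasSum_inv_mul_inv_add_one {s : ℂ} (hs : 0 < s.re) :
    HasSum (fun n : ℕ => ((s + n) * (s + n + 1))⁻¹) s⁻¹ := by
  have hne : ∀ n : ℕ, s + n ≠ 0 := add_natCast_ne_zero hs
  have hterm : ∀ n : ℕ, ((s + n) * (s + n + 1))⁻¹ = (s + n)⁻¹ - (s + (n + 1 : ℕ))⁻¹ := by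
    intro n
    have h1 := hne n
    have h2 := hne (n + 1)
    push_cast at h2 ⊢
    have h3 : s + n + 1 ≠ 0 := by rwa [add_assoc]
    rw [← add_assoc]
    field_simp
    ring
  have hc : 0 < min s.re 1 := lt_min hs one_pos
  have hsum : Summable (fun n : ℕ => ((s + n) * (s + n + 1))⁻¹) := by
    refine Summable.of_norm_bounded
      (summable_nat_succ_rpow_neg_three_halves.mul_left ((min s.re 1) ^ 2)⁻¹) fun n => ?_
    have h1 := min_mul_le_norm_add_natCast s n
    have h2 := min_mul_le_norm_add_natCast s (n + 1)
    push_cast at h2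
    rw [← add_assoc] at h2
    have hn : (0 : ℝ) < (n : ℝ) + 1 := by positivity
    have h4 : ((n : ℝ) + 1) ^ (3 / 2 : ℝ) ≤ ((n : ℝ) + 1) ^ 2 := by
      rw [← Real.rpow_natCast]
      exact Real.rpow_le_rpow_of_exponent_le (by linarith [n.cast_nonneg (α := ℝ)]) (by norm_num)
    rw [Real.rpow_neg hn.le, ← mul_inv, norm_inv, norm_mul]
    refine inv_anti₀ (by positivity) ?_
    calc min s.re 1 ^ 2 * ((n : ℝ) + 1) ^ (3 / 2 : ℝ) ≤ min s.re 1 ^ 2 * ((n : ℝ) + 1) ^ 2 := by gcongr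
      _ = (min s.re 1 * ((n : ℝ) + 1)) * (min s.re 1 * ((n : ℝ) + 1)) := by ring
      _ ≤ ‖s + n‖ * ‖s + n + 1‖ := by
        refine mul_le_mul h1 (le_trans ?_ h2) (by positivity) (norm_nonneg _)
        gcongr
        linarith
  rw [hsum.hasSum_iff_tendsto_nat]
  simp only [hterm]
  simp only [Finset.sum_range_sub']
  simpa using (tendsto_inv_add_natCast s).const_sub s⁻¹

theorem summable_inv_mul_inv_add_one_div {s b : ℂ} (hs : 0 < s.re) (hb : 0 < b.re) :
    Summable fun x : ℕ × ℕ =>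
      (b + x.1)⁻¹ * ((s + x.1 + x.2) * (s + x.1 + x.2 + 1))⁻¹ := by
  set c := min s.re 1
  have hc : 0 < c := lt_min hs one_pos
  set c' := min b.re 1
  have hc' : 0 < c' := lt_min hb one_pos
  have h := summable_nat_succ_rpow_neg_three_halves.mul_of_nonneg
    summable_nat_succ_rpow_neg_three_halves (fun n => by positivity) (fun n => by positivity)
  refine Summable.of_norm_bounded (h.mul_left (c' * c ^ 2)⁻¹) ?_
  rintro ⟨m, n⟩
  have h0 := min_mul_le_norm_add_natCast b m
  have h1 := min_mul_le_norm_add_natCast s (m + n)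
  have h2 := min_mul_le_norm_add_natCast s (m + n + 1)
  push_cast at h1 h2
  rw [← add_assoc] at h1 h2
  rw [← add_assoc] at h2
  have hm : (0 : ℝ) ≤ m := m.cast_nonneg
  have hn : (0 : ℝ) ≤ n := n.cast_nonneg
  have hm1 : (0 : ℝ) < (m : ℝ) + 1 := by positivity
  have hn1 : (0 : ℝ) < (n : ℝ) + 1 := by positivity
  simp only
  rw [Real.rpow_neg hm1.le, Real.rpow_neg hn1.le, ← mul_inv, ← mul_inv, ← mul_inv, norm_inv,
    norm_mul, norm_mul]
  refine inv_anti₀ (by positivity) ?_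
  -- Half a power of `m + n + 1` is given up to `m + 1`, leaving the exponent `3/2 > 1` in each
  -- variable.
  have h4 : ((m : ℝ) + 1) ^ (3 / 2 : ℝ) * ((n : ℝ) + 1) ^ (3 / 2 : ℝ) ≤
      ((m : ℝ) + 1) * ((m : ℝ) + n + 1) ^ 2 := by
    have e1 : ((m : ℝ) + 1) ^ (3 / 2 : ℝ) = ((m : ℝ) + 1) * ((m : ℝ) + 1) ^ (1 / 2 : ℝ) := by
      rw [← Real.rpow_one_add' hm1.le (by norm_num)]
      norm_num
    have e2 : ((m : ℝ) + n + 1) ^ 2 =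
        ((m : ℝ) + n + 1) ^ (1 / 2 : ℝ) * ((m : ℝ) + n + 1) ^ (3 / 2 : ℝ) := by
      rw [← Real.rpow_add (by positivity), ← Real.rpow_natCast]
      norm_num
    rw [e1, e2, mul_assoc]
    gcongr <;> linarith
  calc c' * c ^ 2 * (((m : ℝ) + 1) ^ (3 / 2 : ℝ) * ((n : ℝ) + 1) ^ (3 / 2 : ℝ))
      ≤ c' * c ^ 2 * (((m : ℝ) + 1) * ((m : ℝ) + n + 1) ^ 2) := by gcongr
    _ = (c' * ((m : ℝ) + 1)) * ((c * ((m : ℝ) + n + 1)) * (c * ((m : ℝ) + n + 1))) := by ring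
    _ ≤ ‖b + m‖ * (‖s + m + n‖ * ‖s + m + n + 1‖) := by
      refine mul_le_mul h0 (mul_le_mul h1 (le_trans ?_ h2) (by positivity) (norm_nonneg _))
        (by positivity) (norm_nonneg _)
      exact mul_le_mul_of_nonneg_left (by linarith) hc.le

theorem hasSum_inv_mul_inv_add_one_div {s b : ℂ} (hs : 0 < s.re) (hb : 0 < b.re) {B : ℂ}
    (hB : HasSum (fun m : ℕ => (b + m)⁻¹ * (s + m)⁻¹) B) :
    HasSum (fun x : ℕ × ℕ => (b + x.1)⁻¹ * ((s + x.1 + x.2) * (s + x.1 + x.2 + 1))⁻¹) B := by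
  have key : ∀ m : ℕ, HasSum (fun n : ℕ => (b + m)⁻¹ * ((s + m + n) * (s + m + n + 1))⁻¹)
      ((b + m)⁻¹ * (s + m)⁻¹) := fun m => by
    have hsm : 0 < (s + m).re := by
      have : (0 : ℝ) ≤ m := m.cast_nonneg
      simp
      linarith
    exact (hasSum_inv_mul_inv_add_one hsm).mul_left _
  obtain ⟨B', hB'⟩ := summable_inv_mul_inv_add_one_div hs hb
  have h2 := hB'.prod_fiberwise key
  rwa [h2.unique hB] at hB'

/-- The double sum `∑ 1 / ((a + n) (b + m) (a + b - 1 + n + m))` telescopes to single sums. -/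
theorem hasSum_double_eq_add {a b s : ℂ} (hab : a + b = s + 1) (ha : 0 < a.re) (hb : 0 < b.re)
    (hs : 0 < s.re) {A B : ℂ} (hA : HasSum (fun n : ℕ => (a + n)⁻¹ * (s + n)⁻¹) A)
    (hB : HasSum (fun m : ℕ => (b + m)⁻¹ * (s + m)⁻¹) B) :
    HasSum (fun x : ℕ × ℕ => (a + x.1)⁻¹ * ((b + x.2)⁻¹ * (s + x.1 + x.2)⁻¹)) (A + B) := by
  have h1 := hasSum_inv_mul_inv_add_one_div hs ha hA
  have h2 := (Equiv.prodComm ℕ ℕ).hasSum_iff.2 (hasSum_inv_mul_inv_add_one_div hs hb hB)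
  refine (h1.add h2).congr_fun ?_
  rintro ⟨n, m⟩
  have e1 := add_natCast_ne_zero ha n
  have e2 := add_natCast_ne_zero hb m
  have e3 : s + n + m ≠ 0 := by
    have := add_natCast_ne_zero hs (n + m)
    push_cast at this
    rwa [← add_assoc] at this
  have e4 : s + n + m + 1 ≠ 0 := by
    have := add_natCast_ne_zero hs (n + m + 1)
    push_cast at this
    rwa [← add_assoc, ← add_assoc] at this
  simp only [Function.comp_apply, Equiv.prodComm_apply, Prod.swap_prod_mk]
  rw [show s + m + n = s + n + m by ring]
  -- The partial fraction `1/(xy) = (1/x + 1/y)/(x + y)` with `x = a + n`, `y = b + m` turns each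
  -- term into two that telescope, one in `m` and one in `n`.
  have e5 : s + n + m + 1 = (a + n) + (b + m) := by linear_combination -hab
  rw [e5] at e4 ⊢
  field_simp
  ring

end Telescoping

/-! ### The half-plane model and the Gram identity -/

/-- The half-plane `Re w > -1/2`. -/
abbrev HalfPlane : Type := {w : ℂ // -(1 / 2) < w.re}

namespace HalfPlane

theorem mem_of_disc {r : ℝ} (hr : r ≤ 3 / 2) (w : Disc r) : -(1 / 2) < (w : ℂ).re := by
  have h1 := (abs_lt.1 ((Complex.abs_re_le_norm _).trans_lt (H2.norm_sub_one_lt w))).1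
  simp only [Complex.sub_re, Complex.one_re] at h1
  linarith

/-- Translation by a natural number. -/
def shift (w : HalfPlane) (n : ℕ) : HalfPlane :=
  ⟨w + n, by
    have := w.2
    have hn : (0 : ℝ) ≤ n := n.cast_nonneg
    simp only [Complex.add_re, Complex.natCast_re]
    linarith⟩

theorem coe_shift (w : HalfPlane) (n : ℕ) : (shift w n : ℂ) = w + n := rfl

theorem re_add_one_pos (w : HalfPlane) : 0 < ((w : ℂ) + 1).re := by
  have := w.2
  simp only [Complex.add_re, Complex.one_re]
  linarith

theorem add_one_ne_zero (w : HalfPlane) : (w : ℂ) + 1 ≠ 0 := by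
  simpa using add_natCast_ne_zero w.re_add_one_pos 0

theorem inv_mem (w : HalfPlane) : 1 / ((w : ℂ) + 1) ∈ Disc 1 := by
  have hne := w.add_one_ne_zero
  have hw := w.2
  rw [mem_ball, dist_eq_norm]
  have e : 1 / ((w : ℂ) + 1) - 1 = -(w : ℂ) / ((w : ℂ) + 1) := by
    field_simp
    ring
  rw [e, norm_div, norm_neg, div_lt_one (norm_pos_iff.2 hne)]
  refine lt_of_pow_lt_pow_left₀ 2 (norm_nonneg _) ?_
  rw [Complex.sq_norm, Complex.sq_norm, Complex.normSq_apply, Complex.normSq_apply]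
  simp
  nlinarith

/-- The map `w ↦ 1 / (w + 1)` of the half-plane `Re w > -1/2` onto the disc `D_1`. -/
def invBranch (w : HalfPlane) : Disc 1 := ⟨1 / ((w : ℂ) + 1), w.inv_mem⟩

theorem re_add_conj_add_one_pos (w z : HalfPlane) :
    0 < ((w : ℂ) + (starRingEnd ℂ) (z : ℂ) + 1).re := by
  have := w.2
  have := z.2
  simp only [Complex.add_re, Complex.conj_re, Complex.one_re]
  linarith

theorem add_conj_add_one_ne_zero (w z : HalfPlane) :
    (w : ℂ) + (starRingEnd ℂ) (z : ℂ) + 1 ≠ 0 := by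
  simpa using add_natCast_ne_zero (re_add_conj_add_one_pos w z) 0

/-- The vector in `H²(D_1)` representing `f ↦ (w + 1)⁻¹ f (1 / (w + 1))`. -/
def branchVec (w : HalfPlane) : H2 1 :=
  (starRingEnd ℂ) ((w : ℂ) + 1)⁻¹ • H2.kern 1 w.invBranch

theorem inner_branchVec (w : HalfPlane) (f : H2 1) :
    inner ℂ w.branchVec f = ((w : ℂ) + 1)⁻¹ * f w.invBranch := by
  rw [branchVec, inner_smul_left, Complex.conj_conj, H2.inner_kern]

/-- The vectors `branchVec w` have the Szegő kernel of the half-plane as their Gram kernel. -/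
theorem inner_branchVec_branchVec (w z : HalfPlane) :
    inner ℂ w.branchVec z.branchVec = ((w : ℂ) + (starRingEnd ℂ) (z : ℂ) + 1)⁻¹ := by
  have h1 := w.add_one_ne_zero
  have h2 : (starRingEnd ℂ) (z : ℂ) + 1 ≠ 0 := by
    simpa using (map_ne_zero (starRingEnd ℂ)).2 z.add_one_ne_zero
  have h3 := add_conj_add_one_ne_zero w z
  rw [branchVec, branchVec, inner_smul_left, inner_smul_right, H2.inner_kern_kern]
  simp only [invBranch, map_inv₀, map_add, map_one, map_sub, map_div₀, Complex.conj_conj,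
    Complex.ofReal_one]
  have e : (1 : ℂ) - (1 / ((w : ℂ) + 1) - 1) * (1 / ((starRingEnd ℂ) (z : ℂ) + 1) - 1) / 1 ^ 2 =
      ((w : ℂ) + (starRingEnd ℂ) (z : ℂ) + 1) /
        (((w : ℂ) + 1) * ((starRingEnd ℂ) (z : ℂ) + 1)) := by
    field_simp
    ring
  rw [e, inv_div]
  field_simp

theorem norm_branchVec_sq (w : HalfPlane) : ‖w.branchVec‖ ^ 2 = (2 * (w : ℂ).re + 1)⁻¹ := by
  have h := inner_branchVec_branchVec w w
  rw [inner_self_eq_norm_sq_to_K, Complex.add_conj] at h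
  have : (((2 * (w : ℂ).re : ℝ) : ℂ) + 1)⁻¹ = (((2 * (w : ℂ).re + 1)⁻¹ : ℝ) : ℂ) := by
    push_cast
    rfl
  rw [this] at h
  exact Complex.ofReal_injective ((Complex.ofReal_pow _ _).trans h)

theorem summable_branchVec (w : HalfPlane) :
    Summable fun n : ℕ => (starRingEnd ℂ) ((w : ℂ) + 1 + n)⁻¹ • (w.shift n).branchVec := by
  refine (summable_nat_add_iff 1).1 (Summable.of_norm_bounded
    summable_nat_succ_rpow_neg_three_halves fun n => ?_)
  have hw := w.2
  have hn : (0 : ℝ) < (n : ℝ) + 1 := by positivity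
  have h1 : (n : ℝ) + 1 ≤ ‖(w : ℂ) + 1 + (n + 1 : ℕ)‖ := by
    refine le_trans ?_ (re_add_natCast_le_norm _ _)
    simp only [Complex.add_re, Complex.one_re]
    push_cast
    linarith
  have h2 : ‖(w.shift (n + 1)).branchVec‖ ≤ ((n : ℝ) + 1) ^ (-(1 / 2) : ℝ) := by
    refine le_of_sq_le_sq ?_ (by positivity)
    rw [norm_branchVec_sq, ← Real.rpow_natCast, ← Real.rpow_mul hn.le]
    norm_num
    rw [Real.rpow_neg_one]
    refine inv_anti₀ hn ?_
    simp only [coe_shift, Complex.add_re, Complex.natCast_re]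
    push_cast
    linarith
  rw [norm_smul, RCLike.norm_conj, norm_inv]
  calc ‖(w : ℂ) + 1 + (n + 1 : ℕ)‖⁻¹ * ‖(w.shift (n + 1)).branchVec‖
      ≤ ((n : ℝ) + 1)⁻¹ * ((n : ℝ) + 1) ^ (-(1 / 2) : ℝ) := by gcongr
    _ = ((n : ℝ) + 1) ^ (-(3 / 2) : ℝ) := by
      rw [← Real.rpow_neg_one, ← Real.rpow_add hn]
      norm_num

/-- The vector in `H²(D_1)` representing `f ↦ ∑ (w + n)⁻² f (1 / (w + n))`. -/
def gkwVec (w : HalfPlane) : H2 1 :=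
  ∑' n : ℕ, (starRingEnd ℂ) ((w : ℂ) + 1 + n)⁻¹ • (w.shift n).branchVec

theorem hasSum_inner_gkwVec (w : HalfPlane) (f : H2 1) :
    HasSum (fun n : ℕ => ((w : ℂ) + 1 + n)⁻¹ * inner ℂ (w.shift n).branchVec f)
      (inner ℂ w.gkwVec f) := by
  have h := (innerSL ℂ f).hasSum w.summable_branchVec.hasSum
  have h2 := Complex.hasSum_conj'.2 h 
  simp only [innerSL_apply_apply, inner_conj_symm, inner_smul_right, map_mul, Complex.conj_conj] at h2
  exact h2

/-- Expanding both vectors in Szegő kernels gives the double sum of `hasSum_double_eq_add` with `a =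
w + 1`, `b = conj z + 1`; its two single sums are the two mixed inner products. -/
theorem inner_gkwVec_gkwVec (w z : HalfPlane) : inner ℂ w.gkwVec z.gkwVec =
    inner ℂ w.gkwVec z.branchVec + inner ℂ w.branchVec z.gkwVec := by
  set s : ℂ := (w : ℂ) + (starRingEnd ℂ) (z : ℂ) + 1 with hs
  set a : ℂ := (w : ℂ) + 1
  set b : ℂ := (starRingEnd ℂ) (z : ℂ) + 1 with hb
  have hs0 : 0 < s.re := re_add_conj_add_one_pos w z
  have ha0 : 0 < a.re := w.re_add_one_pos
  have hb0 : 0 < b.re := by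
    have := z.re_add_one_pos
    simpa [hb] using this
  have hA : HasSum (fun n : ℕ => (a + n)⁻¹ * (s + n)⁻¹) (inner ℂ w.gkwVec z.branchVec) := by
    refine (w.hasSum_inner_gkwVec z.branchVec).congr_fun fun n => ?_
    rw [inner_branchVec_branchVec, coe_shift, hs]
    congr 2
    ring
  -- Needed at every translate `w.shift n` for the inner sums below, not only at the given `w`.
  have hB' : ∀ w : HalfPlane, HasSum (fun m : ℕ => (b + m)⁻¹ *
      ((w : ℂ) + (starRingEnd ℂ) (z : ℂ) + 1 + m)⁻¹) (inner ℂ w.branchVec z.gkwVec) := by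
    intro w
    have h := Complex.hasSum_conj'.2 (z.hasSum_inner_gkwVec w.branchVec)
    rw [inner_conj_symm] at h
    refine h.congr_fun fun m => ?_
    rw [inner_branchVec_branchVec, coe_shift]
    simp only [map_mul, map_inv₀, map_add, map_one, map_natCast, Complex.conj_conj, hb]
    congr 2
    ring
  have hd := hasSum_double_eq_add (by rw [hs]; ring) ha0 hb0 hs0 hA (hB' w)
  have hZ := hd.prod_fiberwise (g := fun n : ℕ => (a + n)⁻¹ *
      inner ℂ (w.shift n).branchVec z.gkwVec) fun n => by
    refine ((hB' (w.shift n)).mul_left _).congr_fun fun m => ?_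
    rw [coe_shift, hs]
    congr 3
    ring
  exact (w.hasSum_inner_gkwVec z.gkwVec).unique hZ

/-- The Gram identity makes `branchVec - gkwVec` isometric to `branchVec`; the triangle inequality
does the rest. -/
theorem norm_linearCombination_gkwVec_le (c : HalfPlane →₀ ℂ) :
    ‖Finsupp.linearCombination ℂ gkwVec c‖ ≤ 2 * ‖Finsupp.linearCombination ℂ branchVec c‖ := by
  have h1 := norm_linearCombination_eq_of_gram_eq (x := fun w => branchVec w - gkwVec w)
    (y := branchVec) (fun w z => by
      rw [inner_sub_left, inner_sub_right, inner_sub_right, inner_gkwVec_gkwVec]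
      ring) c
  have h2 : Finsupp.linearCombination ℂ gkwVec c = Finsupp.linearCombination ℂ branchVec c -
      Finsupp.linearCombination ℂ (fun w => branchVec w - gkwVec w) c := by
    simp [Finsupp.linearCombination_apply, Finsupp.sum, smul_sub]
  rw [h2, two_mul]
  exact (norm_sub_le _ _).trans_eq (by rw [h1])

end HalfPlane

/-- A point of a disc `D_r`, `r ≤ 3/2`, as a point of the half-plane. -/
def HalfPlane.ofDisc {r : ℝ} (hr : r ≤ 3 / 2) (w : Disc r) : HalfPlane :=
  ⟨w, HalfPlane.mem_of_disc hr w⟩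

/-! ### Existence of the operator and a lower bound for its norm -/

open HalfPlane

theorem invBranch_shift_ofDisc (n : ℕ) (w : Disc (3 / 2)) :
    ((ofDisc le_rfl w).shift n).invBranch = gaussBranch n w :=
  Subtype.ext (by simp [invBranch, gaussBranch, coe_shift, ofDisc, add_assoc])

theorem hasSum_gauss (f : H2 1) (w : Disc (3 / 2)) :
    HasSum (fun n : ℕ => 1 / ((w : ℂ) + (n + 1)) ^ 2 * f (gaussBranch n w))
      (inner ℂ (gkwVec (ofDisc le_rfl w)) f) := by
  refine ((ofDisc le_rfl w).hasSum_inner_gkwVec f).congr_fun fun n => ?_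
  rw [inner_branchVec, invBranch_shift_ofDisc, ← mul_assoc, ← mul_inv, one_div]
  congr 2
  simp only [coe_shift, ofDisc]
  ring

theorem IsGKWOperator.apply_eq_inner {T : H2 1 →L[ℂ] H2 (3 / 2)} (hT : IsGKWOperator T)
    (f : H2 1) (w : Disc (3 / 2)) : T f w = inner ℂ (gkwVec (ofDisc le_rfl w)) f :=
  (hT f w).unique (hasSum_gauss f w)

theorem IsGKWOperator.eq {T T' : H2 1 →L[ℂ] H2 (3 / 2)} (hT : IsGKWOperator T)
    (hT' : IsGKWOperator T') : T = T' := by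
  ext f
  exact H2.ext_apply fun w => (hT f w).unique (hT' f w)

theorem norm_linearCombination_branchVec_le (c : Disc (3 / 2) →₀ ℂ) :
    ‖Finsupp.linearCombination ℂ (fun w => branchVec (ofDisc le_rfl w)) c‖ ≤
      ‖Finsupp.linearCombination ℂ (H2.kern (3 / 2)) c‖ := by
  set lam : ℝ := Real.sqrt (3 / 2)
  have hlam : (lam : ℂ) * lam = 3 / 2 := by
    rw [← Complex.ofReal_mul, Real.mul_self_sqrt (by norm_num)]
    norm_num
  have hlam1 : 1 ≤ lam := Real.one_le_sqrt.2 (by norm_num)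
  -- With `k` the kernel of `D_{3/2}` and `σ` the Szegő kernel, `k - (3/2) σ = (2/3) (w + 1/2) (conj
  -- z + 1/2) k σ`. The linear factors vanish at `-1/2`, where the circle touches the line. The
  -- factor `2/3 * lam` is a square root of `2/3`.
  have h := norm_linearCombination_le_of_gram_sub_eq_mul (x := H2.kern (3 / 2))
    (y := fun w => (lam : ℂ) • branchVec (ofDisc le_rfl w))
    (u := fun w => (starRingEnd ℂ) ((w : ℂ) + 1 / 2) • H2.kern (3 / 2) w)
    (v := fun w => (2 / 3 * lam : ℂ) • branchVec (ofDisc le_rfl w)) (fun w z => by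
      have h1 : inner ℂ (H2.kern (3 / 2) w) (H2.kern (3 / 2) z) = _ := H2.inner_kern_kern w z
      have hne : (1 : ℂ) - ((w : ℂ) - 1) * (starRingEnd ℂ) ((z : ℂ) - 1) / ((3 / 2 : ℝ) : ℂ) ^ 2 ≠ 0 := by
        intro h0
        have hw := H2.norm_sub_one_lt w
        have hz := H2.norm_sub_one_lt z
        have h2 := congrArg norm (sub_eq_zero.1 h0)
        rw [norm_one, norm_div, norm_mul, RCLike.norm_conj, norm_pow, Complex.norm_real,
          Real.norm_of_nonneg (by norm_num), eq_div_iff (by norm_num), one_mul] at h2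
        have := mul_lt_mul'' hw hz (norm_nonneg _) (norm_nonneg _)
        linarith
      have hne2 : (w : ℂ) + (starRingEnd ℂ) (z : ℂ) + 1 ≠ 0 :=
        add_conj_add_one_ne_zero (ofDisc le_rfl w) (ofDisc le_rfl z)
      simp only [inner_smul_left, inner_smul_right, inner_branchVec_branchVec, h1,
        Complex.conj_conj, Complex.conj_ofReal, ofDisc, map_mul, map_div₀, map_ofNat, map_add,
        map_sub, map_one]
      simp only [map_sub, map_one] at hne
      push_cast at hne ⊢
      generalize (starRingEnd ℂ) (z : ℂ) = q at *
      generalize (w : ℂ) = p at *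
      have e : ((lam : ℂ) * (lam * (p + q + 1)⁻¹)) = 3 / 2 * (p + q + 1)⁻¹ := by
        rw [← mul_assoc, hlam]
      have e' : (2 / 3 * (lam : ℂ) * (2 / 3 * lam * (p + q + 1)⁻¹)) = 2 / 3 * (p + q + 1)⁻¹ := by
        linear_combination (4 / 9) * (p + q + 1)⁻¹ * hlam
      rw [e, e']
      have hne3 : (9 : ℂ) - 4 * (p - 1) * (q - 1) ≠ 0 := by
        intro h0
        apply hne
        linear_combination (1 / 9) * h0
      have e3 : (1 : ℂ) - (p - 1) * (q - 1) / (3 / 2) ^ 2 = (9 - 4 * (p - 1) * (q - 1)) / 9 := by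
        ring
      rw [e3]
      field_simp
      ring) c
  refine le_trans ?_ h
  have h2 : Finsupp.linearCombination ℂ (fun w : Disc (3 / 2) =>
      (lam : ℂ) • branchVec (ofDisc le_rfl w)) c =
      (lam : ℂ) • Finsupp.linearCombination ℂ (fun w => branchVec (ofDisc le_rfl w)) c := by
    simp [Finsupp.linearCombination_apply, Finsupp.sum, Finset.smul_sum, smul_comm (lam : ℂ)]
  rw [h2, norm_smul, Complex.norm_real, Real.norm_of_nonneg (by linarith)]
  exact le_mul_of_one_le_left (norm_nonneg _) hlam1

/-- The adjoint is built first: `k_w ↦ gkwVec w` on kernels of `H²(D_{3/2})` is bounded by the two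
comparisons through `branchVec`, and by the reproducing property its adjoint evaluates to the
required series. -/
theorem exists_isGKWOperator : ∃ T, IsGKWOperator T := by
  obtain ⟨A, -, hA⟩ := exists_clm_of_norm_linearCombination_le (x := H2.kern (3 / 2))
    (y := fun w => gkwVec (ofDisc le_rfl w)) H2.kern_total zero_le_two fun c => by
      have h := norm_linearCombination_gkwVec_le (c.mapDomain (ofDisc le_rfl))
      rw [Finsupp.linearCombination_mapDomain, Finsupp.linearCombination_mapDomain] at h
      exact h.trans (mul_le_mul_of_nonneg_left (norm_linearCombination_branchVec_le c) zero_le_two)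
  refine ⟨ContinuousLinearMap.adjoint A, fun f w => ?_⟩
  have h : (ContinuousLinearMap.adjoint A) f w = inner ℂ (gkwVec (ofDisc le_rfl w)) f := by
    rw [← H2.inner_kern, ContinuousLinearMap.adjoint_inner_right, hA]
  rw [h]
  exact hasSum_gauss f w

/-- The invariant density `1 / (1 + w)` gives a lower bound for the norm. -/
theorem IsGKWOperator.le_norm_sq {T : H2 1 →L[ℂ] H2 (3 / 2)} (hT : IsGKWOperator T) :
    12 / 7 ≤ ‖T‖ ^ 2 := by
  have ha : (1 / 2 : ℂ) ∈ Disc 1 := by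
    rw [mem_ball_iff_norm]
    norm_num
  have hb : (-1 / 8 : ℂ) ∈ Disc (3 / 2) := by
    rw [mem_ball_iff_norm]
    norm_num
  -- Both kernels equal `2 / (z + 1)`, on `D_1` and `D_{3/2}` respectively; hence the points `1/2`
  -- and `-1/8`. Their squared norms are the kernels' diagonal values `4/3` and `16/7`, with ratio
  -- `12/7`.
  set f : H2 1 := H2.kern 1 ⟨_, ha⟩ with hf
  set g : H2 (3 / 2) := H2.kern (3 / 2) ⟨_, hb⟩ with hg
  have hca : (starRingEnd ℂ) ((1 / 2 : ℂ) - 1) = -1 / 2 := by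
    rw [show ((1 / 2 : ℂ) - 1) = ((-1 / 2 : ℝ) : ℂ) by push_cast; ring, Complex.conj_ofReal]
    push_cast
    ring
  have hcb : (starRingEnd ℂ) ((-1 / 8 : ℂ) - 1) = -9 / 8 := by
    rw [show ((-1 / 8 : ℂ) - 1) = ((-9 / 8 : ℝ) : ℂ) by push_cast; ring, Complex.conj_ofReal]
    push_cast
    ring
  have hTf : T f = g := by
    refine H2.ext_apply fun w => (hT f w).unique ?_
    have hw := (ofDisc le_rfl w).re_add_one_pos
    have h := (hasSum_inv_mul_inv_add_one hw).mul_left 2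
    have e : g w = 2 * ((w : ℂ) + 1)⁻¹ := by
      rw [hg, H2.kern_apply]
      rw [hcb]
      have hne := (ofDisc le_rfl w).add_one_ne_zero
      simp only [ofDisc] at hne
      have e2 : (1 : ℂ) - ((w : ℂ) - 1) * (-9 / 8) / ((3 / 2 : ℝ) : ℂ) ^ 2 = ((w : ℂ) + 1) / 2 := by
        push_cast
        ring
      rw [e2, inv_div]
      rfl
    rw [e]
    refine h.congr_fun fun n => ?_
    rw [hf, H2.kern_apply]
    rw [hca]
    have h1 : (w : ℂ) + (n + 1) ≠ 0 := by
      have := ((ofDisc le_rfl w).shift n).add_one_ne_zero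
      rwa [coe_shift, add_assoc] at this
    have h2 : (w : ℂ) + (n + 1) + 1 ≠ 0 := by
      have := ((ofDisc le_rfl w).shift (n + 1)).add_one_ne_zero
      rw [coe_shift] at this
      push_cast at this
      exact this
    simp only [gaussBranch, ofDisc, Complex.ofReal_one, one_pow, div_one]
    rw [show (w : ℂ) + 1 + n = (w : ℂ) + (n + 1) by ring]
    generalize (w : ℂ) + (n + 1) = v at *
    have e3 : (1 : ℂ) - (1 / v - 1) * (-1 / 2) = (v + 1) / (2 * v) := by
      field_simp
      ring
    rw [e3]
    field_simp
  have hnf : ‖f‖ ^ 2 = 4 / 3 := by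
    have h := inner_self_eq_norm_sq_to_K (𝕜 := ℂ) f
    rw [hf, H2.inner_kern_kern] at h
    have h2 : ((‖f‖ ^ 2 : ℝ) : ℂ) = ((4 / 3 : ℝ) : ℂ) := by
      rw [Complex.ofReal_pow]
      refine h.symm.trans ?_
      rw [hca]
      norm_num
    exact_mod_cast h2
  have hng : ‖g‖ ^ 2 = 16 / 7 := by
    have h := inner_self_eq_norm_sq_to_K (𝕜 := ℂ) g
    rw [hg, H2.inner_kern_kern] at h
    have h2 : ((‖g‖ ^ 2 : ℝ) : ℂ) = ((16 / 7 : ℝ) : ℂ) := by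
      rw [Complex.ofReal_pow]
      refine h.symm.trans ?_
      rw [hcb]
      norm_num
    exact_mod_cast h2
  have h := pow_le_pow_left₀ (norm_nonneg _) (T.le_opNorm f) 2
  rw [hTf, mul_pow, hnf, hng] at h
  linarith

/-! ### The golden-ratio coordinate and the sharper factorization -/

open HalfPlane Real

/-- The golden ratio. -/
def gold : ℝ := goldenRatio

theorem gold_sq : gold ^ 2 = gold + 1 := goldenRatio_sq

theorem one_lt_gold : 1 < gold := one_lt_goldenRatio

theorem gold_lt_two : gold < 2 := goldenRatio_lt_two

theorem gold_pos : 0 < gold := goldenRatio_pos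

instance fact_pos_two_sub_gold : Fact (0 < 2 - gold) :=
  ⟨sub_pos.2 gold_lt_two⟩

theorem two_sub_gold_le_one : 2 - gold ≤ 1 := by
  linarith [one_lt_gold]

theorem ofReal_gold_sq : (gold : ℂ) ^ 2 = gold + 1 := by
  exact_mod_cast congrArg (fun x : ℝ => (x : ℂ)) gold_sq

namespace HalfPlane

theorem add_gold_ne_zero (w : HalfPlane) : (w : ℂ) + gold ≠ 0 := by
  intro h
  have h1 := congrArg Complex.re h
  have := w.2
  have := one_lt_gold
  simp at h1
  linarith

/-- The Möbius coordinate of the half-plane centred at the fixed point `φ - 1` of `1 / (w + 1)`,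
with values in the unit disc. -/
def mobius (w : HalfPlane) : ℂ := ((w : ℂ) - (gold - 1)) / ((w : ℂ) + gold)

theorem norm_mobius_lt_of_sq_lt (w : HalfPlane) {r : ℝ} (hr : 0 ≤ r)
    (h : ((w : ℂ).re - (gold - 1)) ^ 2 + (w : ℂ).im ^ 2 <
      r ^ 2 * (((w : ℂ).re + gold) ^ 2 + (w : ℂ).im ^ 2)) : ‖w.mobius‖ < r := by
  rw [mobius, norm_div, div_lt_iff₀ (norm_pos_iff.2 w.add_gold_ne_zero)]
  refine lt_of_pow_lt_pow_left₀ 2 (by positivity) ?_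
  rw [mul_pow, Complex.sq_norm, Complex.sq_norm, Complex.normSq_apply, Complex.normSq_apply]
  simp only [Complex.sub_re, Complex.sub_im, Complex.add_re, Complex.add_im, Complex.ofReal_re,
    Complex.ofReal_im, Complex.one_re, Complex.one_im]
  linarith

theorem norm_mobius_lt_one (w : HalfPlane) : ‖w.mobius‖ < 1 := by
  refine w.norm_mobius_lt_of_sq_lt zero_le_one ?_
  have := w.2
  have := one_lt_gold
  have h2 := gold_sq
  nlinarith [mul_pos (show 0 < 2 * gold - 1 by linarith)
    (show 0 < 2 * (w : ℂ).re + 1 by linarith)]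

/-- `D_1` is the image of the half-plane under `1 / (w + 1)`, which in this coordinate is
multiplication by `-φ⁻²`, and `2 - φ = φ⁻²`. The polynomial identity in the proof verifies this. -/
theorem norm_mobius_ofDisc_lt (w : Disc 1) :
    ‖(ofDisc (by norm_num) w).mobius‖ < 2 - gold := by
  refine norm_mobius_lt_of_sq_lt _ (sub_pos.2 gold_lt_two).le ?_
  have hw := pow_lt_pow_left₀ (H2.norm_sub_one_lt w) (norm_nonneg _) two_ne_zero
  rw [Complex.sq_norm, Complex.normSq_apply] at hw
  simp only [Complex.sub_re, Complex.sub_im, Complex.one_re, Complex.one_im] at hw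
  change ((w : ℂ).re - (gold - 1)) ^ 2 + (w : ℂ).im ^ 2 <
      (2 - gold) ^ 2 * (((w : ℂ).re + gold) ^ 2 + (w : ℂ).im ^ 2)
  have h2 := gold_sq
  have h43 : 0 < 3 * gold - 4 := by
    have : (4 / 3 : ℝ) < gold := by nlinarith [one_lt_gold]
    linarith
  generalize gold = p at *
  generalize (w : ℂ).re = x at *
  generalize (w : ℂ).im = y at *
  have e : (2 - p) ^ 2 * ((x + p) ^ 2 + y ^ 2) - ((x - (p - 1)) ^ 2 + y ^ 2) =
      (3 * p - 4) * (1 - ((x - 1) * (x - 1) + (y - 0) * (y - 0))) := by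
    linear_combination (x ^ 2 + y ^ 2 + x * (2 * p - 6) + (p ^ 2 - 3 * p + 1)) * h2
  have := mul_pos h43 (show 0 < 1 - ((x - 1) * (x - 1) + (y - 0) * (y - 0)) by linarith)
  linarith

/-- `mobius`, recentred to take values in the disc `D_1`. -/
def toDisc (w : HalfPlane) : Disc 1 :=
  ⟨1 + w.mobius, by simpa [mem_ball_iff_norm] using w.norm_mobius_lt_one⟩

/-- The witness inverts the Möbius coordinate: a rescaled Cayley transform of `z - 1`. -/
theorem exists_toDisc_eq (z : Disc 1) : ∃ w : HalfPlane, w.toDisc = z := by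
  set u : ℂ := (z : ℂ) - 1 with hu
  have hu1 : ‖u‖ < 1 := H2.norm_sub_one_lt z
  have hne : 1 - u ≠ 0 := by
    intro h
    rw [← sub_eq_zero.1 h, norm_one] at hu1
    exact hu1.false
  set D : ℝ := 2 * gold - 1 with hD
  have hD0 : 0 < D := by linarith [one_lt_gold]
  have hD0' : (D : ℂ) ≠ 0 := by exact_mod_cast hD0.ne'
  have hDC : (D : ℂ) = 2 * gold - 1 := by
    rw [hD]
    push_cast
    ring
  have hre : 0 < ((1 + u) / (1 - u)).re := by
    have h1 := pow_lt_pow_left₀ hu1 (norm_nonneg _) two_ne_zero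
    rw [Complex.sq_norm, Complex.normSq_apply] at h1
    rw [Complex.div_re, ← add_div]
    refine div_pos ?_ (Complex.normSq_pos.2 hne)
    simp
    nlinarith
  refine ⟨⟨((D / 2 : ℝ) : ℂ) * ((1 + u) / (1 - u)) - ((1 / 2 : ℝ) : ℂ), ?_⟩, Subtype.ext ?_⟩
  · rw [Complex.sub_re, Complex.re_ofReal_mul, Complex.ofReal_re]
    have := mul_pos (half_pos hD0) hre
    linarith
  · have e1 : ((D / 2 : ℝ) : ℂ) * ((1 + u) / (1 - u)) - ((1 / 2 : ℝ) : ℂ) + gold =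
        D / (1 - u) := by
      have : (gold : ℂ) = (D + 1) / 2 := by rw [hDC]; ring
      rw [this]
      push_cast
      field_simp
      ring
    have e2 : ((D / 2 : ℝ) : ℂ) * ((1 + u) / (1 - u)) - ((1 / 2 : ℝ) : ℂ) - (gold - 1) =
        D * u / (1 - u) := by
      have : (gold : ℂ) = (D + 1) / 2 := by rw [hDC]; ring
      rw [this]
      push_cast
      field_simp
      ring
    change 1 + (_ - _) / (_ + _) = _
    rw [e1, e2, div_div_div_cancel_right₀ hne, mul_div_cancel_left₀ _ hD0', hu]
    ring

/-- A second total family with the Szegő kernel of the half-plane as its Gram kernel. -/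
def mobiusVec (w : HalfPlane) : H2 1 :=
  ((√(2 * gold - 1) : ℝ) / (starRingEnd ℂ) ((w : ℂ) + gold) : ℂ) • H2.kern 1 w.toDisc

theorem inner_mobiusVec (w : HalfPlane) (f : H2 1) : inner ℂ w.mobiusVec f =
    (√(2 * gold - 1) : ℝ) / ((w : ℂ) + gold) * f w.toDisc := by
  rw [mobiusVec, inner_smul_left, H2.inner_kern, map_div₀, Complex.conj_conj, Complex.conj_ofReal]

theorem mobiusVec_total (f : H2 1) (h : ∀ w : HalfPlane, inner ℂ w.mobiusVec f = 0) : f = 0 := by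
  refine H2.ext_apply fun z => ?_
  obtain ⟨w, rfl⟩ := exists_toDisc_eq z
  have hs : ((√(2 * gold - 1) : ℝ) : ℂ) ≠ 0 := by
    exact_mod_cast (Real.sqrt_pos.2 (by linarith [one_lt_gold])).ne'
  have := h w
  rw [inner_mobiusVec] at this
  exact (mul_eq_zero.1 this).resolve_left (div_ne_zero hs w.add_gold_ne_zero)

theorem conj_add_gold_ne_zero (w : HalfPlane) :
    (starRingEnd ℂ) (w : ℂ) + gold ≠ 0 := by
  simpa using (map_ne_zero (starRingEnd ℂ)).2 w.add_gold_ne_zero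

/-- Conformal covariance of the Szegő kernel; the weight is a square root of the derivative `(2φ -
1) / (w + φ)²` of `mobius`, up to conjugation. -/
theorem inner_mobiusVec_mobiusVec (w z : HalfPlane) :
    inner ℂ w.mobiusVec z.mobiusVec = inner ℂ w.branchVec z.branchVec := by
  have hs : ((√(2 * gold - 1) : ℝ) : ℂ) * (√(2 * gold - 1) : ℝ) =
      2 * gold - 1 := by
    rw [← Complex.ofReal_mul, Real.mul_self_sqrt (by linarith [one_lt_gold])]
    push_cast
    ring
  have hs0 : ((√(2 * gold - 1) : ℝ) : ℂ) ≠ 0 := by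
    exact_mod_cast (Real.sqrt_pos.2 (by linarith [one_lt_gold])).ne'
  have h1 := w.add_gold_ne_zero
  have h2 := z.conj_add_gold_ne_zero
  have h3 := add_conj_add_one_ne_zero w z
  rw [inner_branchVec_branchVec, mobiusVec, mobiusVec, inner_smul_left, inner_smul_right,
    H2.inner_kern_kern]
  simp only [toDisc, mobius, map_div₀, map_add, map_sub, map_one, Complex.conj_conj,
    Complex.conj_ofReal, add_sub_cancel_left, Complex.ofReal_one, one_pow, div_one]
  have h4 := ofReal_gold_sq
  generalize (starRingEnd ℂ) (z : ℂ) = q at *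
  generalize (w : ℂ) = p at *
  generalize (gold : ℂ) = g at *
  generalize ((√(2 * gold - 1) : ℝ) : ℂ) = s at *
  have e : 1 - (p - (g - 1)) / (p + g) * ((q - (g - 1)) / (q + g)) =
      (2 * g - 1) * (p + q + 1) / ((p + g) * (q + g)) := by
    field_simp
    ring
  rw [e, inv_div, ← hs]
  field_simp

end HalfPlane

theorem norm_linearCombination_gkwVec_le_mobiusVec (c : HalfPlane →₀ ℂ) :
    ‖Finsupp.linearCombination ℂ gkwVec c‖ ≤ 2 * ‖Finsupp.linearCombination ℂ mobiusVec c‖ := by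
  rw [norm_linearCombination_eq_of_gram_eq inner_mobiusVec_mobiusVec]
  exact norm_linearCombination_gkwVec_le c

/-- `mobius` maps `D_1` into the disc of radius `2 - φ = φ⁻²`. -/
def mobiusDisc (w : Disc 1) : Disc (2 - gold) :=
  ⟨1 + (ofDisc (by norm_num) w).mobius, by
    simpa [mem_ball_iff_norm] using norm_mobius_ofDisc_lt w⟩

/-- The image of the kernel of `H²(D_1)` under the unitary map onto `H²(D_{2-φ})` induced by
`mobius`. -/
def mobiusKern (w : Disc 1) : H2 (2 - gold) :=
  ((√(2 * gold - 1) : ℝ) * gold / (starRingEnd ℂ) ((w : ℂ) + gold) : ℂ) •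
    H2.kern (2 - gold) (mobiusDisc w)

theorem inner_mobiusKern_mobiusKern (w z : Disc 1) :
    inner ℂ (H2.kern 1 w) (H2.kern 1 z) = inner ℂ (mobiusKern w) (mobiusKern z) := by
  have hs : ((√(2 * gold - 1) : ℝ) : ℂ) * (√(2 * gold - 1) : ℝ) =
      2 * gold - 1 := by
    rw [← Complex.ofReal_mul, Real.mul_self_sqrt (by linarith [one_lt_gold])]
    push_cast
    ring
  have hs0 : ((√(2 * gold - 1) : ℝ) : ℂ) ≠ 0 := by
    exact_mod_cast (Real.sqrt_pos.2 (by linarith [one_lt_gold])).ne'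
  have hg0 : (gold : ℂ) ≠ 0 := by exact_mod_cast gold_pos.ne'
  have h1 := (ofDisc (by norm_num) w).add_gold_ne_zero
  have h2 := (ofDisc (by norm_num) z).conj_add_gold_ne_zero
  have h3 : (1 : ℂ) - ((w : ℂ) - 1) * ((starRingEnd ℂ) (z : ℂ) - 1) ≠ 0 := by
    intro h0
    have hw := H2.norm_sub_one_lt w
    have hz := H2.norm_sub_one_lt z
    have h2 := congrArg norm (sub_eq_zero.1 h0)
    rw [← map_one (starRingEnd ℂ), ← map_sub, map_one, norm_one, norm_mul, RCLike.norm_conj] at h2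
    have := mul_lt_mul'' hw hz (norm_nonneg _) (norm_nonneg _)
    linarith
  rw [mobiusKern, mobiusKern, inner_smul_left, inner_smul_right, H2.inner_kern_kern,
    H2.inner_kern_kern]
  simp only [ofDisc] at h1 h2
  simp only [mobiusDisc, ofDisc, mobius, map_div₀, map_mul, map_add, map_sub, map_one,
    Complex.conj_conj, Complex.conj_ofReal, add_sub_cancel_left, Complex.ofReal_one, one_pow,
    div_one, Complex.ofReal_sub, Complex.ofReal_ofNat]
  have h4 := ofReal_gold_sq
  generalize (starRingEnd ℂ) (z : ℂ) = q at *
  generalize (w : ℂ) = p at *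
  generalize (gold : ℂ) = g at *
  generalize ((√(2 * gold - 1) : ℝ) : ℂ) = s at *
  have hinv : ((2 - g) ^ 2)⁻¹ = 3 * g + 2 :=
    inv_eq_of_mul_eq_one_right (by linear_combination (3 * g - 7) * h4)
  have e : 1 - (p - (g - 1)) / (p + g) * ((q - (g - 1)) / (q + g)) / (2 - g) ^ 2 =
      (3 * g + 1) * (1 - (p - 1) * (q - 1)) / ((p + g) * (q + g)) := by
    rw [div_eq_mul_inv _ ((2 - g) ^ 2), hinv]
    field_simp
    linear_combination (3 * (p + q) - 3 * g + 2) * h4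
  have hsg : 3 * g + 1 = (s * g) * (s * g) := by
    linear_combination (-g ^ 2) * hs + (-2 * g - 1) * h4
  rw [e, inv_div, hsg]
  field_simp

theorem adjoint_restrict_kern {r R : ℝ} [Fact (0 < r)] [Fact (0 < R)] (h : r ≤ R) (z : Disc r) :
    ContinuousLinearMap.adjoint (H2.restrict h) (H2.kern r z) =
      H2.kern R ⟨z, ball_subset_ball h z.2⟩ := by
  refine ext_inner_right ℂ fun f => ?_
  rw [ContinuousLinearMap.adjoint_inner_left, H2.inner_kern, H2.inner_kern, H2.restrict_apply]

/-- On `H²(D_1)` the Gauss--Kuzmin--Wirsing operator factors through the restriction from the unit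
disc to the disc of radius `φ⁻²`. -/
theorem IsGKWOperator.approxBy_golden {T : H2 1 →L[ℂ] H2 (3 / 2)} (hT : IsGKWOperator T) :
    ApproxBy (restrictionS ∘L T) fun i => 2 * gold⁻¹ * (gold⁻¹ ^ 2) ^ i := by
  -- `B` sends `mobiusVec` to `gkwVec` with norm at most `2`, while `J` is isometric from `H²(D_1)`
  -- to `H²(D_{2-φ})`. The factor `φ` in `hkey` is the extra weight in `mobiusKern`, and it supplies
  -- the `φ⁻¹` of the constant.
  obtain ⟨B, hB, hBv⟩ := exists_clm_of_norm_linearCombination_le mobiusVec_total zero_le_two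
    norm_linearCombination_gkwVec_le_mobiusVec
  obtain ⟨J, hJ, hJv⟩ := exists_clm_of_norm_linearCombination_le (x := H2.kern 1) (y := mobiusKern)
    H2.kern_total zero_le_one fun c => by
      rw [one_mul, norm_linearCombination_eq_of_gram_eq inner_mobiusKern_mobiusKern]
  set Q := H2.restrict two_sub_gold_le_one
  have hg0 : (gold : ℂ) ≠ 0 := by exact_mod_cast gold_pos.ne'
  have hkey : ∀ w : Disc 1, B (ContinuousLinearMap.adjoint Q (J (H2.kern 1 w))) =
      (gold : ℂ) • gkwVec (ofDisc (by norm_num) w) := by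
    intro w
    rw [hJv, mobiusKern, map_smul, adjoint_restrict_kern, ← hBv, mobiusVec, map_smul, map_smul,
      smul_smul]
    congr 1
    simp only [ofDisc]
    ring
  have hfac : restrictionS ∘L T = (((gold⁻¹ : ℝ) : ℂ) • ContinuousLinearMap.adjoint J) ∘L
      (Q ∘L ContinuousLinearMap.adjoint B) := by
    ext f
    refine H2.ext_apply fun w => ?_
    have h1 : (restrictionS ∘L T) f w = inner ℂ (gkwVec (ofDisc (by norm_num) w)) f :=
      hT.apply_eq_inner f ⟨w, ball_subset_ball (by norm_num) w.2⟩
    rw [h1, ← H2.inner_kern]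
    simp only [ContinuousLinearMap.comp_apply, smul_apply, inner_smul_right]
    rw [ContinuousLinearMap.adjoint_inner_right, ← ContinuousLinearMap.adjoint_inner_left Q,
      ContinuousLinearMap.adjoint_inner_right, hkey, inner_smul_left, Complex.conj_ofReal]
    push_cast
    rw [inv_mul_cancel_left₀ hg0]
  rw [hfac]
  refine (((H2.approxBy_restrict two_sub_gold_le_one).comp_clm _).clm_comp _).mono fun i => ?_
  have hρ : 2 - gold = gold⁻¹ ^ 2 := by
    rw [inv_pow]
    exact eq_inv_of_mul_eq_one_left (by linear_combination (1 - gold) * gold_sq)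
  have hi : ((2 - gold) / 1) ^ i = (gold⁻¹ ^ 2) ^ i := by rw [div_one, hρ]
  have hg1 : 0 < gold⁻¹ := inv_pos.2 gold_pos
  rw [hi, norm_smul, Complex.norm_real, Real.norm_of_nonneg hg1.le,
    LinearIsometryEquiv.norm_map, LinearIsometryEquiv.norm_map]
  calc gold⁻¹ * ‖J‖ * ((gold⁻¹ ^ 2) ^ i * ‖B‖) ≤ gold⁻¹ * 1 * ((gold⁻¹ ^ 2) ^ i * 2) := by gcongr
    _ = _ := by ring

/-! ### Assembly -/

/-- The exponents sum to `2 (0 + ⋯ + m) = m (m + 1)`, so the geometric mean of the errors `c q²ⁱ` is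
exactly `c qᵐ`. -/
theorem prod_range_mul_sq_pow (c q : ℝ) (m : ℕ) :
    ∏ i ∈ Finset.range (m + 1), c * (q ^ 2) ^ i = (c * q ^ m) ^ (m + 1) := by
  induction m with
  | zero => simp
  | succ m ih =>
    rw [Finset.prod_range_succ, ih]
    ring

end

theorem corollary4p9 :
    (∃! 𝓛 : H2 1 →L[ℂ] H2 (3 / 2), IsGKWOperator 𝓛) ∧
    ∀ (𝓛 : H2 1 →L[ℂ] H2 (3 / 2)), IsGKWOperator 𝓛 →
    ∀ (L₁ : H2 1 →L[ℂ] H2 1) (L₃₂ : H2 (3 / 2) →L[ℂ] H2 (3 / 2)),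
      L₁ = restrictionS ∘L 𝓛 → L₃₂ = 𝓛 ∘L restrictionS →
      (∀ m : ℕ, 1 ≤ m → approxNumber L₁ m ≤ ‖𝓛‖ * (2 / 3) ^ (m - 1)) ∧
      (∀ m : ℕ, 1 ≤ m → approxNumber L₃₂ m ≤ ‖𝓛‖ * (2 / 3) ^ (m - 1)) ∧
      (IsTraceClass L₁ ∧ ∀ t, HasTraceNorm L₁ t → t ≤ 3 * ‖𝓛‖) ∧
      (IsTraceClass L₃₂ ∧ ∀ t, HasTraceNorm L₃₂ t → t ≤ 3 * ‖𝓛‖) ∧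
      ((∃ ev, IsEigenvalueSequence L₁ ev) ∧ ∀ ev, IsEigenvalueSequence L₁ ev →
        (∀ m : ℕ, ‖ev m‖ ≤ ‖𝓛‖ * (2 / 3) ^ m) ∧ Summable (fun m => ‖ev m‖)) ∧
      ((∃ ev, IsEigenvalueSequence L₃₂ ev) ∧ ∀ ev, IsEigenvalueSequence L₃₂ ev →
        (∀ m : ℕ, ‖ev m‖ ≤ ‖𝓛‖ * (2 / 3) ^ m) ∧ Summable (fun m => ‖ev m‖)) := by
  have hSa : ApproxBy restrictionS fun i => (2 / 3) ^ i :=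
    (H2.approxBy_restrict (r := 1) (R := 3 / 2) (by norm_num)).mono fun i =>
      (by norm_num : ((1 : ℝ) / (3 / 2)) ^ i = (2 / 3) ^ i).le
  obtain ⟨T₀, hT₀⟩ := exists_isGKWOperator
  refine ⟨⟨T₀, hT₀, fun T hT => hT.eq hT₀⟩, ?_⟩
  rintro T hT _ _ rfl rfl
  have hq0 : (0 : ℝ) ≤ 2 / 3 := by norm_num
  have hq1 : (2 / 3 : ℝ) < 1 := by norm_num
  have ha1 : ApproxBy (restrictionS ∘L T) fun i => ‖T‖ * (2 / 3) ^ i :=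
    (hSa.comp_clm T).mono fun i => (mul_comm _ _).le
  have ha2 : ApproxBy (T ∘L restrictionS) fun i => ‖T‖ * (2 / 3) ^ i := hSa.clm_comp T
  have hα : Filter.Tendsto (fun i : ℕ => ‖T‖ * (2 / 3 : ℝ) ^ i) Filter.atTop (nhds 0) := by
    simpa using (tendsto_pow_atTop_nhds_zero_of_lt_one hq0 hq1).const_mul ‖T‖
  have hsum : ‖T‖ * (1 - 2 / 3)⁻¹ = 3 * ‖T‖ := by ring
  -- The rational bound `19/12 ≤ φ` suffices: `(24/19)² < 12/7`.
  have hψ : 2 * gold⁻¹ ≤ ‖T‖ := by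
    refine le_of_sq_le_sq (le_trans ?_ hT.le_norm_sq) (norm_nonneg T)
    have : (19 / 12 : ℝ) ≤ gold := by nlinarith [one_lt_gold, gold_sq]
    have h2 : gold⁻¹ ≤ (19 / 12 : ℝ)⁻¹ := inv_anti₀ (by norm_num) this
    have h3 := inv_pos.2 gold_pos
    nlinarith
  have hψ2 : gold⁻¹ ≤ 2 / 3 := by
    have : (3 / 2 : ℝ) ≤ gold := by nlinarith [one_lt_gold, gold_sq]
    exact (inv_anti₀ (by norm_num) this).trans (by norm_num)
  -- The golden errors are used here; those of `ha1` would give only the rate `(2/3) ^ (m/2)`.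
  have hev : ∀ ev, IsEigenvalueSequence (restrictionS ∘L T) ev →
      (∀ m : ℕ, ‖ev m‖ ≤ ‖T‖ * (2 / 3) ^ m) ∧ Summable (fun m => ‖ev m‖) := by
    intro ev h
    have hg1 : 0 < gold⁻¹ := inv_pos.2 gold_pos
    have hb : ∀ m : ℕ, ‖ev m‖ ≤ ‖T‖ * (2 / 3) ^ m := fun m =>
      (h.norm_le hT.approxBy_golden m (by positivity) (prod_range_mul_sq_pow _ _ m).le).trans
        (mul_le_mul hψ (pow_le_pow_left₀ hg1.le hψ2 m) (by positivity) (norm_nonneg T))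
    exact ⟨hb, Summable.of_nonneg_of_le (fun _ => norm_nonneg _) hb
      ((summable_geometric_of_lt_one hq0 hq1).mul_left _)⟩
  exact ⟨fun m hm => ha1.approxNumber_le hm, fun m hm => ha2.approxNumber_le hm,
    ⟨ha1.isTraceClass hq0 hq1, fun t ht => (ha1.traceNorm_le hq0 hq1 ht).trans_eq hsum⟩,
    ⟨ha2.isTraceClass hq0 hq1, fun t ht => (ha2.traceNorm_le hq0 hq1 ht).trans_eq hsum⟩,
    ⟨exists_isEigenvalueSequence ha1 hα, hev⟩,
    ⟨exists_isEigenvalueSequence ha2 hα, fun ev h => hev ev h.comp_comm⟩⟩
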